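/- Let $\mathcal H$ be a complex Hilbert space, let $2\le k\le\dim\mathcal H$, and let $c=(c_1,\dots,c_k)\in\mathbb R^k$ with $c_1\ge\dots\ge c_k$, not all $c_j$ equal. For a bounded operator $A$ on $\mathcal H$ put $$W_c(A)=\Big\{\sum_{j=1}^k c_j\langle Ae_j,e_j\rangle : e_1,\dots,e_k \text{ orthonormal in } \mathcal H\Big\}.$$ If $\dim\mathcal H=k$ put $\bar c_j=\tilde c_j=c_j$; if $\dim\mathcal H>k$ put $\bar c_j=\max\{c_j,0\}$ and $\tilde c_j=\min\{c_j,0\}$. Let $A$ be a bounded operator of rank two which, with respect to a suitable orthonormal basis, has the form $A=\begin{pmatrix}a&d\\0&b\end{pmatrix}\oplus 0$ with $a,b,d\in\mathbb C$. 1. If $a\ge b>0$ and $d=0$, then $W_c(A)$ is the line segment $[\tilde c_k a+\tilde c_{k-1}b,\ \bar c_1a+\bar c_2b]$, except when $\dim\mathcal H=k+1$ and either $c_1<0$ or $c_k>0$. If $\dim\mathcal H=k+1$ and $c_1<0$, then $W_c(A)=[c_ka+c_{k-1}b,\ c_1b]$; if $\dim\mathcal H=k+1$ and $c_k>0$, then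 $W_c(A)=[c_kb,\ c_1a+c_2b]$. 2. If $a>0>b$ and $d=0$, then $W_c(A)$ is the line segment $[\tilde c_ka+\bar c_1b,\ \bar c_1a+\tilde c_kb]$. 3. If $0>a\ge b$ and $d=0$, then $W_c(A)$ is the line segment $[\bar c_1b+\bar c_2a,\ \tilde c_kb+\tilde c_{k-1}a]$, except when $\dim\mathcal H=k+1$ and either $c_1<0$ or $c_k>0$. If $\dim\mathcal H=k+1$ and $c_1<0$, then $W_c(A)=[c_1a,\ c_kb+c_{k-1}a]$; if $\dim\mathcal H=k+1$ and $c_k>0$, then $W_c(A)=[c_1b+c_2a,\ c_ka]$. 4. If $a,b\in\mathbb R$ and $|d|^2>4|ab|$, then $W_c(A)$ is the (closed, non-degenerate) elliptical disk with foci $\bar c_1a+\tilde c_kb$ and $\bar c_1b+\tilde c_ka$ and with minor axis of length $(\bar c_1-\tilde c_k)|d|$. 5. If $\dim\mathcal H\ge3$, $c_1+c_k=c_2+c_{k-1}=0$, $a,b>0$ are real, and $0<|d|^2<4ab$, then $W_c(A)$ is not an elliptical disk (not even a degenerate one, that is, a segment or a point). -/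

import Mathlib

/-- The `c`-numerical range of a bounded operator `A`: all numbers `∑ j, c j * ⟨A e_j, e_j⟩` with
`(e_1, …, e_k)` an orthonormal system. Mathlib's inner product is linear in its second argument. -/
def cNumericalRange {H : Type*} [NormedAddCommGroup H] [InnerProductSpace ℂ H] {k : ℕ}
    (c : Fin k → ℝ) (A : H →L[ℂ] H) : Set ℂ :=
  {z | ∃ e : Fin k → H, Orthonormal ℂ e ∧ z = ∑ j, (c j : ℂ) * inner ℂ (e j) (A (e j))}

open Classical in
/-- `c̄_j`: it is `c_j` if `dim H = k` and `max (c_j) 0` if `dim H > k`. Indices start at `0`. -/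
noncomputable def cBar (H : Type*) [NormedAddCommGroup H] [InnerProductSpace ℂ H] {k : ℕ}
    (c : Fin k → ℝ) (j : Fin k) : ℝ :=
  if Module.rank ℂ H = (k : Cardinal) then c j else max (c j) 0

open Classical in
/-- `c̃_j`: it is `c_j` if `dim H = k` and `min (c_j) 0` if `dim H > k`. Indices start at `0`. -/
noncomputable def cTilde (H : Type*) [NormedAddCommGroup H] [InnerProductSpace ℂ H] {k : ℕ}
    (c : Fin k → ℝ) (j : Fin k) : ℝ :=
  if Module.rank ℂ H = (k : Cardinal) then c j else min (c j) 0

/-- In a suitable orthonormal basis `A` is the block `[[a, d], [0, b]]` plus a zero block: there are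
orthonormal `x, y` with `A x = a x`, `A y = d x + b y`, and `A = 0` on the orthogonal
complement of their span. -/
def HasTriangularForm {H : Type*} [NormedAddCommGroup H] [InnerProductSpace ℂ H]
    (A : H →L[ℂ] H) (a d b : ℂ) : Prop :=
  ∃ x y : H, Orthonormal ℂ ![x, y] ∧ A x = a • x ∧ A y = d • x + b • y ∧
    ∀ z : H, inner ℂ x z = 0 → inner ℂ y z = 0 → A z = 0

/-- The closed elliptical disk with foci `f₁`, `f₂` and minor axis of (full) length `m ≥ 0`. The
major axis has length `√(|f₁ - f₂|² + m²)`. For `m = 0` it is the segment between the foci. -/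
def ellipticalDisk (f₁ f₂ : ℂ) (m : ℝ) : Set ℂ :=
  {z | ‖z - f₁‖ + ‖z - f₂‖ ≤ √(‖f₁ - f₂‖ ^ 2 + m ^ 2)}

/-! Extend `c` by zero weights on `r` further vectors, as many as the dimension permits. Since `A`
lives on a plane, an orthonormal basis `u, v` of that plane may be put at any two positions of the
extended frame, and the value is then `C₁⟨Au,u⟩ + C₂⟨Av,v⟩` with the two weights found there. The
zero slots are the reason for `max (c j) 0` and `min (c j) 0`, and `dim H = k + 1` is exceptional
because there is only one such slot.

Points of the range: rotating `u, v` within the plane lets the Bloch vector run over the unit sphere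
of `ℝ × ℂ`, whose image is an elliptical disk (`ellipticalDisk_subset_cNumericalRange`). For `d =
0`, rotations between eigenvectors join the values belonging to different placements by intervals
(`uIcc_subset_cNumericalRange`).

Bounds: the real part of `conj u * A` has two eigenvalues on the plane. If their signs are weakly
opposite, the two weighted masses can be bounded independently by the extreme weights, which gives
the support function of an ellipse (`planeInner_le_of_mem_cNumericalRange`). The condition `‖d‖ ^ 2
> 4 * |a * b|` makes every direction indefinite, and this yields the elliptical disk. For
semidefinite diagonal `A`, a two-term Ky Fan bound replaces this (`sum_diagonal_le`), sharpened in
codimension one.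

Non-ellipticity: if the range were an elliptical disk, the cone of indefinite directions would
already determine its centre abscissa and its horizontal half-width. In the real direction both
eigenvalues are positive, and a nonnegative second weight produces a point beyond that half-width.
-/

/-! ### Completing orthonormal frames, and Bessel-type mass bounds. -/

section Frames

variable {H : Type*} [NormedAddCommGroup H] [InnerProductSpace ℂ H]

/-- A partially defined orthonormal family can be completed as long as the dimension permits. -/
theorem exists_orthonormal_extension {ι : Type*} [Fintype ι]
    (hcard : (Fintype.card ι : Cardinal) ≤ Module.rank ℂ H) (f : ι → H) (s : Set ι)
    (hf : Orthonormal ℂ (s.domRestrict f)) :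
    ∃ g : ι → H, Orthonormal ℂ g ∧ ∀ i ∈ s, g i = f i := by
  classical
  obtain ⟨l, hl⟩ := Module.le_rank_iff.1 hcard
  -- `H` may be infinite-dimensional, so the completion takes place in a finite-dimensional `S` that
  -- contains `f` and is large enough. The index type is padded by `Fin r` to match `finrank S`
  -- exactly; the surplus basis vectors are discarded.
  let S : Submodule ℂ H := Submodule.span ℂ (Set.range l ∪ Set.range f)
  have hfin : FiniteDimensional ℂ S :=
    FiniteDimensional.span_of_finite ℂ ((Set.finite_range l).union (Set.finite_range f))
  have hlS : ∀ i, l i ∈ S := fun i => Submodule.subset_span (Or.inl ⟨i, rfl⟩)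
  have hfS : ∀ i, f i ∈ S := fun i => Submodule.subset_span (Or.inr ⟨i, rfl⟩)
  have hle : Fintype.card ι ≤ Module.finrank ℂ S := by
    have hl' : LinearIndependent ℂ (fun i => (⟨l i, hlS i⟩ : S)) :=
      LinearIndependent.of_comp S.subtype hl
    simpa using hl'.fintype_card_le_finrank
  obtain ⟨r, hr⟩ := Nat.exists_eq_add_of_le hle
  let F : ι ⊕ Fin r → S := Sum.elim (fun i => ⟨f i, hfS i⟩) 0
  have hF : Orthonormal ℂ ((Sum.inl '' s).domRestrict F) := by
    rw [orthonormal_iff_ite] at hf ⊢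
    rintro ⟨_, i, hi, rfl⟩ ⟨_, j, hj, rfl⟩
    simpa [F, Subtype.ext_iff] using hf ⟨i, hi⟩ ⟨j, hj⟩
  obtain ⟨b, hb⟩ := hF.exists_orthonormalBasis_extension_of_card_eq (by simp [hr])
  refine ⟨fun i => (b (Sum.inl i) : H), ?_, fun i hi => ?_⟩
  · exact (b.orthonormal.comp _ Sum.inl_injective).comp_linearIsometry S.subtypeₗᵢ
  · change (b (Sum.inl i) : H) = f i
    rw [hb _ ⟨i, hi, rfl⟩]
    rfl

theorem orthonormal_pair_iff {u v : H} :
    Orthonormal ℂ ![u, v] ↔ ‖u‖ = 1 ∧ ‖v‖ = 1 ∧ inner ℂ u v = 0 := by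
  rw [orthonormal_vecCons_iff, orthonormal_vecCons_iff]
  simp [and_comm, and_left_comm]

theorem Orthonormal.pair_swap {u v : H} (h : Orthonormal ℂ ![u, v]) : Orthonormal ℂ ![v, u] := by
  rw [orthonormal_pair_iff] at h ⊢
  exact ⟨h.2.1, h.1, inner_eq_zero_symm.1 h.2.2⟩

theorem exists_orthonormal_pair_extension {ι : Type*} [Fintype ι]
    (hcard : (Fintype.card ι : Cardinal) ≤ Module.rank ℂ H) {u v : H}
    (h : Orthonormal ℂ ![u, v]) {i j : ι} (hij : i ≠ j) :
    ∃ g : ι → H, Orthonormal ℂ g ∧ g i = u ∧ g j = v := by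
  classical
  obtain ⟨g, hg, hgs⟩ := exists_orthonormal_extension hcard
    (Function.update (fun _ => u) j v) {i, j} (by
      rw [orthonormal_pair_iff] at h
      have h' := inner_eq_zero_symm.1 h.2.2
      rw [orthonormal_iff_ite]
      rintro ⟨p, hp | hp⟩ ⟨q, hq | hq⟩ <;> subst p <;> subst q <;>
        simp [hij, hij.symm, Function.update, h, h', inner_self_eq_norm_sq_to_K, Subtype.ext_iff])
  refine ⟨g, hg, ?_, ?_⟩
  · rw [hgs i (by simp), Function.update_of_ne hij]
  · rw [hgs j (by simp), Function.update_self]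

theorem Orthonormal.sum_sq_norm_inner_le {ι : Type*} [Fintype ι] {e : ι → H}
    (he : Orthonormal ℂ e) {u : H} (hu : ‖u‖ = 1) : ∑ j, ‖inner ℂ u (e j)‖ ^ 2 ≤ 1 := by
  have := he.sum_inner_products_le u (s := Finset.univ)
  simpa only [norm_inner_symm, hu, one_pow] using this

theorem Orthonormal.sum_sq_norm_inner_eq {ι : Type*} [Fintype ι] [Nonempty ι] {e : ι → H}
    (he : Orthonormal ℂ e) (hdim : Module.rank ℂ H = (Fintype.card ι : Cardinal))
    {u : H} (hu : ‖u‖ = 1) : ∑ j, ‖inner ℂ u (e j)‖ ^ 2 = 1 := by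
  have hfr : Fintype.card ι = Module.finrank ℂ H := by simp [Module.finrank, hdim]
  let B := basisOfOrthonormalOfCardEqFinrank he hfr
  have hB : ⇑B = e := coe_basisOfOrthonormalOfCardEqFinrank he hfr
  let b := OrthonormalBasis.mk he (by rw [← hB, B.span_eq])
  have := b.sum_sq_norm_inner_left u
  simpa [b, hu] using this

theorem Orthonormal.pair_sq_norm_inner_le {u v e : H} (h : Orthonormal ℂ ![u, v])
    (he : ‖e‖ = 1) : ‖inner ℂ u e‖ ^ 2 + ‖inner ℂ v e‖ ^ 2 ≤ 1 := by
  have := h.sum_inner_products_le e (s := Finset.univ)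
  simpa [he] using this

/-- In codimension one, a frame misses at most unit mass of any orthonormal pair. -/
theorem Orthonormal.one_le_sum_pair {ι : Type*} [Fintype ι] {e : ι → H}
    (he : Orthonormal ℂ e) (hdim : Module.rank ℂ H = (Fintype.card ι : Cardinal) + 1)
    {u v : H} (h : Orthonormal ℂ ![u, v]) :
    1 ≤ ∑ j, (‖inner ℂ u (e j)‖ ^ 2 + ‖inner ℂ v (e j)‖ ^ 2) := by
  classical
  have hcard : Module.rank ℂ H = (Fintype.card (Option ι) : Cardinal) := by simp [hdim]
  obtain ⟨g, hg, hgs⟩ := exists_orthonormal_extension (ι := Option ι) hcard.ge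
    (fun o => o.elim 0 e) (Set.range some) (by
      rw [orthonormal_iff_ite] at he ⊢
      rintro ⟨_, i, rfl⟩ ⟨_, j, rfl⟩
      simpa [Subtype.ext_iff] using he i j)
  have hge : ∀ i, g (some i) = e i := fun i => hgs _ ⟨i, rfl⟩
  have h' := orthonormal_pair_iff.1 h
  have hu := hg.sum_sq_norm_inner_eq hcard h'.1
  have hv := hg.sum_sq_norm_inner_eq hcard h'.2.1
  rw [Fintype.sum_option] at hu hv
  simp only [hge] at hu hv
  -- The pair has total mass 2 in the completed basis; by Bessel the one added vector carries at
  -- most 1 of it.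
  have := h.pair_sq_norm_inner_le (hg.1 none)
  rw [Finset.sum_add_distrib]
  linarith

end Frames

/-! ### Elliptical disks: quadratic equation, parametrization, support function. -/

section Ellipse

/-- The Euclidean inner product of the plane. -/
def planeInner (z w : ℂ) : ℝ := z.re * w.re + z.im * w.im

theorem planeInner_add_right (u z w : ℂ) :
    planeInner u (z + w) = planeInner u z + planeInner u w := by
  simp [planeInner]; ring

theorem planeInner_ofReal_mul_right (u : ℂ) (r : ℝ) (z : ℂ) :
    planeInner u (r * z) = r * planeInner u z := by
  simp [planeInner]; ring

theorem planeInner_neg_left (u z : ℂ) : planeInner (-u) z = -planeInner u z := by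
  simp [planeInner]; ring

theorem norm_sq_eq_re_im (z : ℂ) : ‖z‖ ^ 2 = z.re ^ 2 + z.im ^ 2 := by
  rw [← Complex.normSq_eq_norm_sq, Complex.normSq_apply]; ring

theorem planeInner_sq_le (z w : ℂ) : planeInner z w ^ 2 ≤ ‖z‖ ^ 2 * ‖w‖ ^ 2 := by
  rw [norm_sq_eq_re_im, norm_sq_eq_re_im, planeInner]
  nlinarith [sq_nonneg (z.re * w.im - z.im * w.re)]

/-- Squaring the focal inequality twice gives the quadratic one. The bound `‖ζ‖ ≤ M` fixes the sign
needed to undo the second squaring. -/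
theorem sum_focal_dist_le_iff {ζ F : ℂ} {M n : ℝ} (hM : 0 ≤ M) (hMn : M ^ 2 = ‖F‖ ^ 2 + n ^ 2) :
    ‖ζ - F‖ + ‖ζ + F‖ ≤ 2 * M ↔
      ‖ζ‖ ≤ M ∧ M ^ 2 * ‖ζ‖ ^ 2 - planeInner ζ F ^ 2 ≤ M ^ 2 * n ^ 2 := by
  have hp := norm_nonneg (ζ - F)
  have hq := norm_nonneg (ζ + F)
  have h1 : ‖ζ - F‖ ^ 2 = ‖ζ‖ ^ 2 + ‖F‖ ^ 2 - 2 * planeInner ζ F := by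
    simp only [norm_sq_eq_re_im, planeInner, Complex.sub_re, Complex.sub_im]; ring
  have h2 : ‖ζ + F‖ ^ 2 = ‖ζ‖ ^ 2 + ‖F‖ ^ 2 + 2 * planeInner ζ F := by
    simp only [norm_sq_eq_re_im, planeInner, Complex.add_re, Complex.add_im]; ring
  have htri : 2 * ‖ζ‖ ≤ ‖ζ - F‖ + ‖ζ + F‖ := by
    calc 2 * ‖ζ‖ = ‖(ζ - F) + (ζ + F)‖ := by
          rw [show (ζ - F) + (ζ + F) = 2 * ζ by ring, norm_mul]; simp
      _ ≤ _ := norm_add_le _ _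
  set p := ‖ζ - F‖
  set q := ‖ζ + F‖
  set g := planeInner ζ F
  set Z := ‖ζ‖
  set N := ‖F‖
  have hZ : 0 ≤ Z := norm_nonneg ζ
  have hpq : (p * q) ^ 2 = (Z ^ 2 + N ^ 2) ^ 2 - 4 * g ^ 2 := by
    rw [mul_pow, h1, h2]; ring
  have key : (2 * M ^ 2 - Z ^ 2 - N ^ 2) ^ 2 - (p * q) ^ 2 =
      4 * (M ^ 2 * n ^ 2 - (M ^ 2 * Z ^ 2 - g ^ 2)) := by
    rw [hpq]
    have hn : n ^ 2 = M ^ 2 - N ^ 2 := by linarith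
    rw [hn]; ring
  constructor
  · intro h
    have hZM : Z ≤ M := by linarith
    refine ⟨hZM, ?_⟩
    have hsq : (p + q) ^ 2 ≤ (2 * M) ^ 2 := by gcongr
    have hK : p * q ≤ 2 * M ^ 2 - Z ^ 2 - N ^ 2 := by nlinarith
    have : (p * q) ^ 2 ≤ (2 * M ^ 2 - Z ^ 2 - N ^ 2) ^ 2 := by gcongr
    linarith
  · rintro ⟨hZM, h⟩
    have hZ2 : Z ^ 2 ≤ M ^ 2 := by gcongr
    have hK0 : 0 ≤ 2 * M ^ 2 - Z ^ 2 - N ^ 2 := by nlinarith [sq_nonneg n]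
    have hK : p * q ≤ 2 * M ^ 2 - Z ^ 2 - N ^ 2 :=
      abs_le_of_sq_le_sq' (by linarith) hK0 |>.2
    refine abs_le_of_sq_le_sq' (b := 2 * M) ?_ (by linarith) |>.2
    nlinarith

theorem norm_sq_real_mul_add (s n : ℝ) (F w : ℂ) :
    ‖s * F + n * w‖ ^ 2 = s ^ 2 * ‖F‖ ^ 2 + 2 * s * n * planeInner w F + n ^ 2 * ‖w‖ ^ 2 := by
  simp only [norm_sq_eq_re_im, planeInner, Complex.add_re, Complex.add_im, Complex.mul_re,
    Complex.mul_im, Complex.ofReal_re, Complex.ofReal_im]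
  ring

/-- The quadratic equation of an ellipse describes the image of the unit ball of `ℝ × ℂ`. -/
theorem exists_ball_param {ζ F : ℂ} {M n : ℝ} (hM : 0 ≤ M) (hMn : M ^ 2 = ‖F‖ ^ 2 + n ^ 2)
    (hζ : ‖ζ‖ ≤ M) (h : M ^ 2 * ‖ζ‖ ^ 2 - planeInner ζ F ^ 2 ≤ M ^ 2 * n ^ 2) :
    ∃ (s : ℝ) (w : ℂ), s ^ 2 + ‖w‖ ^ 2 ≤ 1 ∧ ζ = s * F + n * w := by
  rcases hM.eq_or_lt with hM0 | hMpos
  · subst hM0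
    exact ⟨0, 0, by simp, by simpa using hζ⟩
  set g := planeInner ζ F with hg
  -- First coordinate of the preimage of `ζ` of least norm under `(s, w) ↦ s * F + n * w`.
  set s := g / M ^ 2 with hs
  have hgs : g = s * M ^ 2 := by rw [hs]; field_simp
  have hsub : ‖ζ - s * F‖ ^ 2 = ‖ζ‖ ^ 2 - 2 * s * g + s ^ 2 * ‖F‖ ^ 2 := by
    simp only [hg, norm_sq_eq_re_im, planeInner, Complex.sub_re, Complex.sub_im, Complex.mul_re,
      Complex.mul_im, Complex.ofReal_re, Complex.ofReal_im]
    ring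
  have hM2 : 0 < M ^ 2 := by positivity
  have h' : ‖ζ‖ ^ 2 - s ^ 2 * M ^ 2 ≤ n ^ 2 := by
    rw [hgs] at h
    have : M ^ 2 * (‖ζ‖ ^ 2 - s ^ 2 * M ^ 2) ≤ M ^ 2 * n ^ 2 := by linarith
    exact le_of_mul_le_mul_left this hM2
  have hbound : ‖ζ - s * F‖ ^ 2 ≤ n ^ 2 * (1 - s ^ 2) := by
    have : ‖F‖ ^ 2 = M ^ 2 - n ^ 2 := by linarith
    rw [hsub, this, hgs]; nlinarith
  rcases eq_or_ne n 0 with hn | hn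
  · refine ⟨s, 0, ?_, ?_⟩
    · have hcs := planeInner_sq_le ζ F
      rw [← hg, hgs] at hcs
      have hF : ‖F‖ ^ 2 = M ^ 2 := by rw [hMn, hn]; ring
      have hZ : ‖ζ‖ ^ 2 ≤ M ^ 2 := by gcongr
      have : M ^ 4 * s ^ 2 ≤ M ^ 4 * 1 := by
        rw [hF] at hcs; nlinarith
      have := le_of_mul_le_mul_left this (by positivity)
      simpa using this
    · have h0 : ‖ζ - s * F‖ ^ 2 = 0 := le_antisymm (by simpa [hn] using hbound) (by positivity)
      have : ζ - s * F = 0 := by simpa using h0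
      rw [sub_eq_zero.1 this]; simp
  · refine ⟨s, (ζ - s * F) / n, ?_, ?_⟩
    · have hn2 : 0 < n ^ 2 := by positivity
      clear_value s
      rw [norm_div, div_pow, Complex.norm_real, Real.norm_eq_abs, sq_abs]
      have := (div_le_iff₀' hn2).2 hbound
      linarith
    · have : (n : ℂ) ≠ 0 := by exact_mod_cast hn
      field_simp
      ring

theorem mem_ellipticalDisk_iff {f₁ f₂ z : ℂ} {m : ℝ} :
    z ∈ ellipticalDisk f₁ f₂ m ↔ ∃ (s : ℝ) (w : ℂ), s ^ 2 + ‖w‖ ^ 2 ≤ 1 ∧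
      z = (f₁ + f₂) / 2 + (s * ((f₁ - f₂) / 2) + (m / 2 : ℝ) * w) := by
  obtain ⟨F, hF⟩ : ∃ F, F = (f₁ - f₂) / 2 := ⟨_, rfl⟩
  obtain ⟨n, hn⟩ : ∃ n, n = m / 2 := ⟨_, rfl⟩
  obtain ⟨ζ, hζ⟩ : ∃ ζ, ζ = z - (f₁ + f₂) / 2 := ⟨_, rfl⟩
  have hM : 0 ≤ √(‖F‖ ^ 2 + n ^ 2) := Real.sqrt_nonneg _
  have hMn : √(‖F‖ ^ 2 + n ^ 2) ^ 2 = ‖F‖ ^ 2 + n ^ 2 := Real.sq_sqrt (by positivity)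
  have hmaj : √(‖f₁ - f₂‖ ^ 2 + m ^ 2) = 2 * √(‖F‖ ^ 2 + n ^ 2) := by
    rw [show ‖f₁ - f₂‖ ^ 2 + m ^ 2 = 2 ^ 2 * (‖F‖ ^ 2 + n ^ 2) by
      rw [hF, hn, norm_div, Complex.norm_ofNat]; ring]
    rw [Real.sqrt_mul (by norm_num), Real.sqrt_sq (by norm_num)]
  have e1 : z - f₁ = ζ - F := by rw [hζ, hF]; ring
  have e2 : z - f₂ = ζ + F := by rw [hζ, hF]; ring
  rw [ellipticalDisk, Set.mem_ofPred_eq, hmaj, e1, e2, sum_focal_dist_le_iff hM hMn, ← hF, ← hn]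
  have hz : ∀ t, z = (f₁ + f₂) / 2 + t ↔ ζ = t := fun t => by
    rw [hζ]; constructor <;> intro h <;> linear_combination h
  simp only [hz]
  constructor
  · rintro ⟨h1, h2⟩
    exact exists_ball_param hM hMn h1 h2
  · rintro ⟨s, w, hsw, rfl⟩
    have hnorm := norm_sq_real_mul_add s n F w
    set M := √(‖F‖ ^ 2 + n ^ 2)
    set r := planeInner w F with hr
    have hcs : r ^ 2 ≤ ‖w‖ ^ 2 * ‖F‖ ^ 2 := planeInner_sq_le w F
    have hg : planeInner (s * F + n * w) F = s * ‖F‖ ^ 2 + n * r := by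
      simp only [hr, norm_sq_eq_re_im, planeInner, Complex.add_re, Complex.add_im, Complex.mul_re,
        Complex.mul_im, Complex.ofReal_re, Complex.ofReal_im]
      ring
    constructor
    · refine abs_le_of_sq_le_sq' ?_ hM |>.2
      have hle : ‖(s : ℂ) * F + n * w‖ ≤ |s| * ‖F‖ + |n| * ‖w‖ := by
        simpa using norm_add_le ((s : ℂ) * F) (n * w)
      have h0 : ‖(s : ℂ) * F + n * w‖ ^ 2 ≤ (|s| * ‖F‖ + |n| * ‖w‖) ^ 2 := by gcongr
      have h1 : (|s| * ‖F‖ + |n| * ‖w‖) ^ 2 ≤ (|s| ^ 2 + ‖w‖ ^ 2) * (‖F‖ ^ 2 + |n| ^ 2) := by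
        nlinarith [sq_nonneg (|s| * |n| - ‖w‖ * ‖F‖)]
      rw [sq_abs, sq_abs, ← hMn] at h1
      nlinarith [sq_nonneg M]
    -- The defect in the quadratic inequality is an exact square.
    · have hexp : M ^ 2 * n ^ 2 * (s ^ 2 + ‖w‖ ^ 2) -
          (M ^ 2 * ‖(s : ℂ) * F + n * w‖ ^ 2 - planeInner (s * F + n * w) F ^ 2) =
          n ^ 2 * (n * s - r) ^ 2 := by
        rw [hnorm, hg, hMn]; ring
      have : M ^ 2 * n ^ 2 * (s ^ 2 + ‖w‖ ^ 2) ≤ M ^ 2 * n ^ 2 * 1 := by gcongr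
      nlinarith [mul_nonneg (sq_nonneg n) (sq_nonneg (n * s - r))]

/-- The points of a non-degenerate elliptical disk come from the unit sphere of `ℝ × ℂ`. -/
theorem exists_sphere_param {f₁ f₂ z : ℂ} {m : ℝ} (hm : 0 < m) (hz : z ∈ ellipticalDisk f₁ f₂ m) :
    ∃ (s : ℝ) (w : ℂ), s ^ 2 + ‖w‖ ^ 2 = 1 ∧
      z = (f₁ + f₂) / 2 + (s * ((f₁ - f₂) / 2) + (m / 2 : ℝ) * w) := by
  obtain ⟨s, w, hsw, rfl⟩ := mem_ellipticalDisk_iff.1 hz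
  -- Moving along the kernel direction `(m / 2, -(f₁ - f₂) / 2)` leaves the image point unchanged.
  -- The squared norm starts at most 1 and later reaches 1, so the line meets the sphere.
  let φ : ℝ → ℝ := fun t =>
    (s + t * (m / 2)) ^ 2 + ‖w - t * ((f₁ - f₂) / 2)‖ ^ 2
  have hφ : Continuous φ := by fun_prop
  have hT : 1 ≤ φ ((1 - s) / (m / 2)) := by
    have : s + (1 - s) / (m / 2) * (m / 2) = 1 := by field_simp; ring
    simp only [φ, this]
    nlinarith [sq_nonneg ‖w - ((1 - s) / (m / 2) : ℝ) * ((f₁ - f₂) / 2)‖]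
  obtain ⟨t, ht⟩ := mem_range_of_exists_le_of_exists_ge hφ ⟨0, by simpa [φ] using hsw⟩ ⟨_, hT⟩
  refine ⟨_, _, ht, ?_⟩
  push_cast
  ring

theorem planeInner_le_of_mem_ellipticalDisk {f₁ f₂ z : ℂ} {m : ℝ} (u : ℂ)
    (hz : z ∈ ellipticalDisk f₁ f₂ m) :
    planeInner u z ≤ planeInner u ((f₁ + f₂) / 2) +
      √(planeInner u ((f₁ - f₂) / 2) ^ 2 + (m / 2) ^ 2 * ‖u‖ ^ 2) := by
  obtain ⟨s, w, hsw, rfl⟩ := mem_ellipticalDisk_iff.1 hz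
  simp only [planeInner_add_right, planeInner_ofReal_mul_right]
  gcongr
  apply Real.le_sqrt_of_sq_le
  set x := planeInner u ((f₁ - f₂) / 2)
  have h1 := planeInner_sq_le u w
  set y := planeInner u w
  have hx : (s * x + m / 2 * y) ^ 2 ≤ (s ^ 2 + ‖w‖ ^ 2) * (x ^ 2 + (m / 2) ^ 2 * ‖u‖ ^ 2) := by
    have h2 : y ≤ ‖u‖ * ‖w‖ ∧ -(‖u‖ * ‖w‖) ≤ y := by
      have := abs_le_of_sq_le_sq' (a := y) (b := ‖u‖ * ‖w‖) (by rw [mul_pow]; exact h1) (by positivity)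
      exact ⟨this.2, this.1⟩
    have h3 : |s * x + m / 2 * y| ≤ |s| * |x| + |m / 2| * (‖u‖ * ‖w‖) := by
      refine (abs_add_le _ _).trans ?_
      rw [abs_mul, abs_mul]
      gcongr
      exact abs_le.2 ⟨h2.2, h2.1⟩
    have h4 : |s * x + m / 2 * y| ^ 2 ≤ (|s| * |x| + |m / 2| * (‖u‖ * ‖w‖)) ^ 2 := by gcongr
    rw [sq_abs] at h4
    rw [← sq_abs s, ← sq_abs x, ← sq_abs (m / 2)]
    nlinarith [sq_nonneg (|s| * (|m / 2| * ‖u‖) - ‖w‖ * |x|)]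
  have : 0 ≤ x ^ 2 + (m / 2) ^ 2 * ‖u‖ ^ 2 := by positivity
  nlinarith

theorem exists_mem_ellipticalDisk_planeInner_eq (f₁ f₂ : ℂ) (m : ℝ) (u : ℂ) :
    ∃ z ∈ ellipticalDisk f₁ f₂ m, planeInner u z = planeInner u ((f₁ + f₂) / 2) +
      √(planeInner u ((f₁ - f₂) / 2) ^ 2 + (m / 2) ^ 2 * ‖u‖ ^ 2) := by
  set x := planeInner u ((f₁ - f₂) / 2) with hx
  have hnn : 0 ≤ x ^ 2 + (m / 2) ^ 2 * ‖u‖ ^ 2 := by positivity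
  have hsq := Real.sq_sqrt hnn
  set h := √(x ^ 2 + (m / 2) ^ 2 * ‖u‖ ^ 2)
  have huu : planeInner u u = ‖u‖ ^ 2 := by rw [norm_sq_eq_re_im, planeInner]; ring
  rcases eq_or_ne h 0 with h0 | h0
  · refine ⟨(f₁ + f₂) / 2, mem_ellipticalDisk_iff.2 ⟨0, 0, by simp, by simp⟩, by simp [h0]⟩
  -- The equality case of Cauchy–Schwarz.
  refine ⟨_, mem_ellipticalDisk_iff.2 ⟨x / h, (m / 2 / h : ℝ) * u, ?_, rfl⟩, ?_⟩
  · rw [norm_mul, mul_pow, Complex.norm_real, Real.norm_eq_abs, sq_abs, div_pow, div_pow, hsq]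
    apply le_of_eq
    rw [← hsq]
    field_simp
    linarith
  · simp only [planeInner_add_right, planeInner_ofReal_mul_right, ← hx, huu]
    field_simp
    linarith

theorem mem_ellipticalDisk_of_planeInner_le {f₁ f₂ z : ℂ} {m : ℝ} (hm : 0 < m)
    (h : ∀ u, planeInner u z ≤ planeInner u ((f₁ + f₂) / 2) +
      √(planeInner u ((f₁ - f₂) / 2) ^ 2 + (m / 2) ^ 2 * ‖u‖ ^ 2)) :
    z ∈ ellipticalDisk f₁ f₂ m := by
  obtain ⟨F, hF⟩ : ∃ F, F = (f₁ - f₂) / 2 := ⟨_, rfl⟩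
  obtain ⟨n, hn⟩ : ∃ n, n = m / 2 := ⟨_, rfl⟩
  obtain ⟨ζ, hζ⟩ : ∃ ζ, ζ = z - (f₁ + f₂) / 2 := ⟨_, rfl⟩
  have hM : 0 ≤ √(‖F‖ ^ 2 + n ^ 2) := Real.sqrt_nonneg _
  have hMn : √(‖F‖ ^ 2 + n ^ 2) ^ 2 = ‖F‖ ^ 2 + n ^ 2 := Real.sq_sqrt (by positivity)
  obtain ⟨M, hMdef⟩ : ∃ M, M = √(‖F‖ ^ 2 + n ^ 2) := ⟨_, rfl⟩
  rw [← hMdef] at hM hMn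
  have hnpos : 0 < n := by linarith
  have hMpos : 0 < M ^ 2 := by rw [hMn]; positivity
  obtain ⟨g, hg⟩ : ∃ g, g = planeInner ζ F := ⟨_, rfl⟩
  -- The test direction is half the gradient at `ζ` of the quadratic form `Q` defined below. The
  -- hypothesis then becomes `Q ≤ √(n ^ 2 * M ^ 2 * Q)`, hence `Q ≤ M ^ 2 * n ^ 2`.
  have hu := h ((M ^ 2 : ℝ) * ζ - (g : ℝ) * F)
  rw [show z = (f₁ + f₂) / 2 + ζ by rw [hζ]; ring, planeInner_add_right, ← hF, ← hn] at hu
  have hu' := le_of_add_le_add_left hu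
  have eζ : planeInner ((M ^ 2 : ℝ) * ζ - (g : ℝ) * F) ζ = M ^ 2 * ‖ζ‖ ^ 2 - g ^ 2 := by
    rw [sq g]
    nth_rw 3 [hg]
    simp only [norm_sq_eq_re_im, planeInner, Complex.sub_re, Complex.sub_im, Complex.mul_re,
      Complex.mul_im, Complex.ofReal_re, Complex.ofReal_im]
    ring
  have eF : planeInner ((M ^ 2 : ℝ) * ζ - (g : ℝ) * F) F = n ^ 2 * g := by
    have : n ^ 2 = M ^ 2 - ‖F‖ ^ 2 := by linarith
    rw [this, sub_mul]
    nth_rw 2 [hg]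
    simp only [norm_sq_eq_re_im, planeInner, Complex.sub_re, Complex.sub_im, Complex.mul_re,
      Complex.mul_im, Complex.ofReal_re, Complex.ofReal_im]
    ring
  have eu : ‖(M ^ 2 : ℝ) * ζ - (g : ℝ) * F‖ ^ 2 =
      M ^ 4 * ‖ζ‖ ^ 2 - 2 * M ^ 2 * g ^ 2 + g ^ 2 * ‖F‖ ^ 2 := by
    have : 2 * M ^ 2 * g ^ 2 = 2 * M ^ 2 * g * planeInner ζ F := by rw [← hg]; ring
    rw [this]
    simp only [norm_sq_eq_re_im, planeInner, Complex.sub_re, Complex.sub_im, Complex.mul_re,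
      Complex.mul_im, Complex.ofReal_re, Complex.ofReal_im]
    ring
  have hF2 : ‖F‖ ^ 2 = M ^ 2 - n ^ 2 := by linarith
  have erad : (n ^ 2 * g) ^ 2 + n ^ 2 * (M ^ 4 * ‖ζ‖ ^ 2 - 2 * M ^ 2 * g ^ 2 + g ^ 2 * ‖F‖ ^ 2) =
      n ^ 2 * M ^ 2 * (M ^ 2 * ‖ζ‖ ^ 2 - g ^ 2) := by
    rw [hF2]; ring
  rw [eζ, eF, eu, erad] at hu'
  set Q := M ^ 2 * ‖ζ‖ ^ 2 - g ^ 2 with hQ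
  have hcs : g ^ 2 ≤ ‖ζ‖ ^ 2 * ‖F‖ ^ 2 := by rw [hg]; exact planeInner_sq_le ζ F
  have hQ0 : n ^ 2 * ‖ζ‖ ^ 2 ≤ Q := by rw [hF2] at hcs; rw [hQ]; linarith
  have hQn : Q ≤ M ^ 2 * n ^ 2 := by
    have hQ0' : 0 ≤ Q := le_trans (by positivity) hQ0
    rcases hQ0'.eq_or_lt with hz | hpos
    · rw [← hz]; positivity
    · have h1 : Q ^ 2 ≤ n ^ 2 * M ^ 2 * Q := by
        calc Q ^ 2 ≤ √(n ^ 2 * M ^ 2 * Q) ^ 2 := by gcongr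
          _ = _ := Real.sq_sqrt (by positivity)
      nlinarith
  have hζM : ‖ζ‖ ≤ M := by
    refine abs_le_of_sq_le_sq' ?_ hM |>.2
    have : n ^ 2 * ‖ζ‖ ^ 2 ≤ n ^ 2 * M ^ 2 := by linarith
    exact le_of_mul_le_mul_left this (by positivity)
  obtain ⟨s, w, hsw, hz⟩ := exists_ball_param hM hMn hζM (by rw [← hg]; exact hQn)
  refine mem_ellipticalDisk_iff.2 ⟨s, w, hsw, ?_⟩
  rw [← hF, ← hn, ← hz, hζ]; ring

/-- Every point of the unit sphere of `ℝ × ℂ` is the Bloch vector of a unit vector of `ℂ²`. -/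
theorem exists_bloch {s : ℝ} {w : ℂ} (h : s ^ 2 + ‖w‖ ^ 2 = 1) :
    ∃ ξ η : ℂ, ‖ξ‖ ^ 2 + ‖η‖ ^ 2 = 1 ∧ ‖ξ‖ ^ 2 - ‖η‖ ^ 2 = s ∧
      2 * (starRingEnd ℂ ξ * η) = w := by
  have hs : -1 ≤ s := by nlinarith [sq_nonneg ‖w‖]
  -- At the south pole `s = -1` the choice of a real positive `ξ` breaks down.
  rcases hs.eq_or_lt with hs1 | hs1
  · have hw : w = 0 := by
      have : ‖w‖ ^ 2 = 0 := by rw [← hs1] at h; linarith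
      simpa using this
    exact ⟨0, 1, by simp, by simp [← hs1], by simp [hw]⟩
  · have hpos : 0 < (1 + s) / 2 := by linarith
    set α := √((1 + s) / 2) with hα
    have hα2 : α ^ 2 = (1 + s) / 2 := Real.sq_sqrt hpos.le
    have hα0 : 0 < α := Real.sqrt_pos.2 hpos
    have hη : ‖w / (2 * α : ℝ)‖ ^ 2 = (1 - s) / 2 := by
      rw [norm_div, div_pow, Complex.norm_real, Real.norm_eq_abs, sq_abs, mul_pow, hα2,
        div_eq_iff (by positivity)]
      nlinarith
    have hξ : ‖(α : ℂ)‖ ^ 2 = (1 + s) / 2 := by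
      rw [Complex.norm_real, Real.norm_eq_abs, sq_abs, hα2]
    refine ⟨α, w / (2 * α : ℝ), by rw [hξ, hη]; ring, by rw [hξ, hη]; ring, ?_⟩
    have : (α : ℂ) ≠ 0 := by exact_mod_cast hα0.ne'
    rw [Complex.conj_ofReal]
    push_cast
    field_simp

end Ellipse

/-! ### Rotating the plane of `A`: points of the range and supporting lines. -/

section Operators

open ComplexConjugate

variable {H : Type*} [NormedAddCommGroup H] [InnerProductSpace ℂ H]

theorem norm_sq_conj_combination (ξ η X Y : ℂ) :
    ‖conj ξ * X + conj η * Y‖ ^ 2 =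
      ‖ξ‖ ^ 2 * ‖X‖ ^ 2 + ‖η‖ ^ 2 * ‖Y‖ ^ 2 + 2 * (conj (conj ξ * η) * (conj X * Y)).re := by
  simp only [norm_sq_eq_re_im, Complex.add_re, Complex.add_im, Complex.mul_re, Complex.mul_im,
    Complex.conj_re, Complex.conj_im]
  ring

theorem orthonormal_pair_rotate {x y : H} (h : Orthonormal ℂ ![x, y]) {ξ η : ℂ}
    (hξη : ‖ξ‖ ^ 2 + ‖η‖ ^ 2 = 1) :
    Orthonormal ℂ ![ξ • x + η • y, -conj η • x + conj ξ • y] := by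
  rw [orthonormal_pair_iff] at h
  obtain ⟨hx, hy, hxy⟩ := h
  have hyx := inner_eq_zero_symm.1 hxy
  have hxx : inner ℂ x x = 1 := by simp [inner_self_eq_norm_sq_to_K, hx]
  have hyy : inner ℂ y y = 1 := by simp [inner_self_eq_norm_sq_to_K, hy]
  have hn : ∀ p q : ℂ, ‖p‖ ^ 2 + ‖q‖ ^ 2 = 1 → ‖p • x + q • y‖ = 1 := by
    intro p q hpq
    have : inner ℂ (p • x + q • y) (p • x + q • y) = 1 := by
      simp only [inner_add_left, inner_add_right, inner_smul_left, inner_smul_right, hxx, hyy,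
        hxy, hyx]
      have hc : ((‖p‖ ^ 2 + ‖q‖ ^ 2 : ℝ) : ℂ) = 1 := by rw [hpq]; simp
      push_cast at hc
      rw [← Complex.conj_mul', ← Complex.conj_mul'] at hc
      linear_combination hc
    rw [norm_eq_sqrt_re_inner (𝕜 := ℂ), this]
    simp
  rw [orthonormal_pair_iff]
  refine ⟨hn _ _ hξη, hn _ _ ?_, ?_⟩
  · rw [norm_neg, Complex.norm_conj, Complex.norm_conj]; linarith
  · simp only [inner_add_left, inner_add_right, inner_smul_left, inner_smul_right, hxx, hyy,
      hxy, hyx]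
    ring

theorem inner_pair_rotate (x y e : H) (ξ η : ℂ) :
    inner ℂ (ξ • x + η • y) e = conj ξ * inner ℂ x e + conj η * inner ℂ y e := by
  simp only [inner_add_left, inner_smul_left]

theorem inner_apply_of_triangular {A : H →L[ℂ] H} {a d b : ℂ} {x y : H}
    (h : Orthonormal ℂ ![x, y]) (hx : A x = a • x) (hy : A y = d • x + b • y)
    (h0 : ∀ z : H, inner ℂ x z = 0 → inner ℂ y z = 0 → A z = 0) (e : H) :
    inner ℂ e (A e) = a * (‖inner ℂ x e‖ ^ 2 : ℝ) + b * (‖inner ℂ y e‖ ^ 2 : ℝ) +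
      d * (conj (inner ℂ x e) * inner ℂ y e) := by
  rw [orthonormal_pair_iff] at h
  obtain ⟨hnx, hny, hxy⟩ := h
  have hyx := inner_eq_zero_symm.1 hxy
  have hxx : inner ℂ x x = 1 := by simp [inner_self_eq_norm_sq_to_K, hnx]
  have hyy : inner ℂ y y = 1 := by simp [inner_self_eq_norm_sq_to_K, hny]
  have hAe : A e = (inner ℂ x e) • (a • x) + (inner ℂ y e) • (d • x + b • y) := by
    have hz := h0 (e - ((inner ℂ x e) • x + (inner ℂ y e) • y))
      (by simp [hnx, hxy])
      (by simp [hny, hyx])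
    rw [map_sub, sub_eq_zero, map_add, map_smul, map_smul, hx, hy] at hz
    exact hz
  rw [hAe]
  simp only [inner_add_right, inner_smul_right]
  rw [← inner_conj_symm e x, ← inner_conj_symm e y]
  push_cast
  rw [← Complex.conj_mul', ← Complex.conj_mul']
  ring

/-- The vectors at positions `Sum.inr` have weight zero; they serve as places to hide part of the
plane of `A`. -/
theorem mem_cNumericalRange_of_extended {k r : ℕ} (c : Fin k → ℝ) (A : H →L[ℂ] H)
    {g : Fin k ⊕ Fin r → H} (hg : Orthonormal ℂ g) :
    ∑ p, ((Sum.elim c 0 p : ℝ) : ℂ) * inner ℂ (g p) (A (g p)) ∈ cNumericalRange c A := by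
  refine ⟨g ∘ Sum.inl, hg.comp _ Sum.inl_injective, ?_⟩
  simp

theorem mem_cNumericalRange_of_pair {k r : ℕ} (c : Fin k → ℝ) {A : H →L[ℂ] H}
    (hcard : ((k + r : ℕ) : Cardinal) ≤ Module.rank ℂ H) {u v : H} (h : Orthonormal ℂ ![u, v])
    (h0 : ∀ z : H, inner ℂ u z = 0 → inner ℂ v z = 0 → A z = 0) {i j : Fin k ⊕ Fin r}
    (hij : i ≠ j) :
    ((Sum.elim c 0 i : ℝ) : ℂ) * inner ℂ u (A u) + ((Sum.elim c 0 j : ℝ) : ℂ) * inner ℂ v (A v) ∈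
      cNumericalRange c A := by
  obtain ⟨g, hg, rfl, rfl⟩ := exists_orthonormal_pair_extension (by simpa using hcard) h hij
  convert mem_cNumericalRange_of_extended c A hg using 1
  rw [Fintype.sum_eq_add i j hij]
  rintro p ⟨hpi, hpj⟩
  rw [h0 (g p) (hg.2 hpi.symm) (hg.2 hpj.symm)]
  simp

theorem mem_cNumericalRange_of_sphere {k r : ℕ} (c : Fin k → ℝ) {A : H →L[ℂ] H}
    (hcard : ((k + r : ℕ) : Cardinal) ≤ Module.rank ℂ H) {a b : ℝ} {d : ℂ}
    (hA : HasTriangularForm A a d b) {i j : Fin k ⊕ Fin r} (hij : i ≠ j) {s : ℝ} {w : ℂ}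
    (hsw : s ^ 2 + ‖w‖ ^ 2 = 1) :
    (((Sum.elim c 0 i + Sum.elim c 0 j) / 2 * (a + b) : ℝ) : ℂ) +
      ((Sum.elim c 0 i - Sum.elim c 0 j : ℝ) : ℂ) * (((a - b) / 2 * s : ℝ) + (‖d‖ / 2 : ℝ) * w) ∈
      cNumericalRange c A := by
  obtain ⟨x, y, hxy, hx, hy, h0⟩ := hA
  -- The phase of `d` is absorbed into the Bloch vector.
  obtain ⟨w', hw', hdw⟩ : ∃ w' : ℂ, ‖w'‖ = ‖w‖ ∧ d * w' = ‖d‖ * w := by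
    rcases eq_or_ne d 0 with rfl | hd
    · exact ⟨w, rfl, by simp⟩
    · have : ‖d‖ ≠ 0 := norm_ne_zero_iff.2 hd
      exact ⟨‖d‖ * w / d, by rw [norm_div, norm_mul]; simp; field_simp, by field_simp⟩
  obtain ⟨ξ, η, h1, h2, h3⟩ := exists_bloch (s := s) (w := w') (by rw [hw', hsw])
  have h1' : conj ξ * ξ + conj η * η = 1 := by
    rw [Complex.conj_mul', Complex.conj_mul']; exact_mod_cast h1
  have h2' : conj ξ * ξ - conj η * η = s := by
    rw [Complex.conj_mul', Complex.conj_mul']; exact_mod_cast h2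
  have horth := orthonormal_pair_rotate hxy h1
  have hker : ∀ z : H, inner ℂ (ξ • x + η • y) z = 0 → inner ℂ (-conj η • x + conj ξ • y) z = 0 →
      A z = 0 := by
    intro z hu hv
    rw [inner_pair_rotate] at hu hv
    simp only [map_neg, Complex.conj_conj] at hv
    apply h0
    · linear_combination ξ * hu - conj η * hv - inner ℂ x z * h1'
    · linear_combination η * hu + conj ξ * hv - inner ℂ y z * h1'
  convert mem_cNumericalRange_of_pair c hcard horth hker hij using 1
  rw [inner_apply_of_triangular hxy hx hy h0, inner_apply_of_triangular hxy hx hy h0]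
  rw [orthonormal_pair_iff] at hxy
  obtain ⟨hnx, hny, hxy⟩ := hxy
  have hyx := inner_eq_zero_symm.1 hxy
  have hxx : inner ℂ x x = 1 := by simp [inner_self_eq_norm_sq_to_K, hnx]
  have hyy : inner ℂ y y = 1 := by simp [inner_self_eq_norm_sq_to_K, hny]
  simp only [inner_add_right, inner_smul_right, hxx, hyy, hxy, hyx, mul_one, mul_zero, add_zero,
    zero_add]
  push_cast
  simp only [← Complex.conj_mul', map_neg, Complex.conj_conj]
  generalize ((Sum.elim c 0 i : ℝ) : ℂ) = p
  generalize ((Sum.elim c 0 j : ℝ) : ℂ) = q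
  linear_combination (-(p + q) / 2 * (a + b)) * h1' - ((p - q) * (a - b) / 2) * h2' -
    ((p - q) / 2) * hdw - ((p - q) / 2 * d) * h3

theorem ellipticalDisk_subset_cNumericalRange {k r : ℕ} (c : Fin k → ℝ) {A : H →L[ℂ] H}
    (hcard : ((k + r : ℕ) : Cardinal) ≤ Module.rank ℂ H) {a b : ℝ} {d : ℂ}
    (hA : HasTriangularForm A a d b) {i j : Fin k ⊕ Fin r} (hij : i ≠ j)
    {C₁ C₂ : ℝ} (hi : Sum.elim c 0 i = C₁) (hj : Sum.elim c 0 j = C₂)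
    (hpos : 0 < (C₁ - C₂) * ‖d‖) :
    ellipticalDisk ((C₁ * a + C₂ * b : ℝ) : ℂ) ((C₁ * b + C₂ * a : ℝ) : ℂ) ((C₁ - C₂) * ‖d‖) ⊆
      cNumericalRange c A := by
  intro z hz
  obtain ⟨s, w, hsw, rfl⟩ := exists_sphere_param hpos hz
  convert mem_cNumericalRange_of_sphere c hcard hA hij hsw using 1
  rw [hi, hj]
  push_cast
  ring

/-- In the directions where the real part of `A` is not definite, the elliptical disk supports the
`c`-numerical range. -/
theorem planeInner_le_of_mem_cNumericalRange {k : ℕ} {c : Fin k → ℝ} {A : H →L[ℂ] H}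
    {a b : ℝ} {d : ℂ} (hA : HasTriangularForm A a d b) (hd : d ≠ 0) {C₁ C₂ : ℝ}
    (hle : ∀ e : Fin k → H, Orthonormal ℂ e → ∀ U : H, ‖U‖ = 1 →
      ∑ j, c j * ‖inner ℂ U (e j)‖ ^ 2 ≤ C₁)
    (hge : ∀ e : Fin k → H, Orthonormal ℂ e → ∀ U : H, ‖U‖ = 1 →
      C₂ ≤ ∑ j, c j * ‖inner ℂ U (e j)‖ ^ 2)
    {u : ℂ} (hu : 4 * (a * b) * u.re ^ 2 ≤ ‖d‖ ^ 2 * ‖u‖ ^ 2) {z : ℂ}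
    (hz : z ∈ cNumericalRange c A) :
    planeInner u z ≤ (C₁ + C₂) / 2 * ((a + b) * u.re) +
      (C₁ - C₂) / 2 * √((a - b) ^ 2 * u.re ^ 2 + ‖d‖ ^ 2 * ‖u‖ ^ 2) := by
  rcases eq_or_ne u 0 with rfl | hu0
  · simp [planeInner]
  obtain ⟨x, y, hxy, hx, hy, h0⟩ := hA
  obtain ⟨e, he, rfl⟩ := hz
  have hpos : 0 < (a - b) ^ 2 * u.re ^ 2 + ‖d‖ ^ 2 * ‖u‖ ^ 2 := by
    have := norm_pos_iff.2 hd
    have := norm_pos_iff.2 hu0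
    positivity
  have hR2 := Real.sq_sqrt hpos.le
  have hR : 0 < √((a - b) ^ 2 * u.re ^ 2 + ‖d‖ ^ 2 * ‖u‖ ^ 2) := Real.sqrt_pos.2 hpos
  set R := √((a - b) ^ 2 * u.re ^ 2 + ‖d‖ ^ 2 * ‖u‖ ^ 2)
  -- This Bloch vector points along the traceless part of the real part of `conj u * A`. The rotated
  -- pair therefore consists of its eigenvectors, with eigenvalues `(α + β ± R) / 2`.
  obtain ⟨ξ, η, h1, h2, h3⟩ := exists_bloch (s := (a - b) * u.re / R)
    (w := conj (conj u * d) / R) (by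
      rw [norm_div, Complex.norm_conj, norm_mul, Complex.norm_conj, Complex.norm_real,
        Real.norm_eq_abs, div_pow, div_pow, sq_abs, hR2, ← add_div, div_eq_one_iff_eq hpos.ne']
      ring)
  have horth := orthonormal_pair_rotate hxy h1
  have hnorm := orthonormal_pair_iff.1 horth
  set α := a * u.re
  set β := b * u.re
  have hform : ∀ f : H, planeInner u (inner ℂ f (A f)) =
      (α + β + R) / 2 * ‖inner ℂ (ξ • x + η • y) f‖ ^ 2 +
      (α + β - R) / 2 * ‖inner ℂ (-conj η • x + conj ξ • y) f‖ ^ 2 := by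
    intro f
    rw [inner_apply_of_triangular hxy hx hy h0, inner_pair_rotate, inner_pair_rotate,
      norm_sq_conj_combination, norm_sq_conj_combination]
    generalize inner ℂ x f = X
    generalize inner ℂ y f = Y
    have e1 : conj (conj (-conj η) * conj ξ) = -conj (conj ξ * η) := by
      simp [mul_comm]
    have e2 : conj (conj ξ * η) = conj u * d / (2 * R : ℝ) := by
      have : conj ξ * η = conj (conj u * d) / (2 * R : ℝ) := by
        rw [Complex.ofReal_mul, Complex.ofReal_ofNat, mul_comm (2 : ℂ), ← div_div, ← h3]; ring
      rw [this, map_div₀, Complex.conj_conj, Complex.conj_ofReal]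
    have e3 : planeInner u (a * (‖X‖ ^ 2 : ℝ) + b * (‖Y‖ ^ 2 : ℝ) + d * (conj X * Y)) =
        α * ‖X‖ ^ 2 + β * ‖Y‖ ^ 2 + (conj u * d * (conj X * Y)).re := by
      simp only [planeInner, α, β, ← Complex.ofReal_mul, ← Complex.ofReal_add, Complex.add_re,
        Complex.add_im, Complex.ofReal_re, Complex.ofReal_im]
      rw [mul_assoc (conj u), Complex.mul_re (conj u), Complex.conj_re, Complex.conj_im]
      ring
    have e4 : (conj u * d / (2 * R : ℝ) * (conj X * Y)).re =
        (conj u * d * (conj X * Y)).re / (2 * R) := by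
      rw [div_mul_eq_mul_div, Complex.div_ofReal_re]
    rw [e1, e2, e3, neg_mul, Complex.neg_re, e4, norm_neg, Complex.norm_conj, Complex.norm_conj]
    have h2' : (‖ξ‖ ^ 2 - ‖η‖ ^ 2) * R = α - β := by
      rw [h2, div_mul_cancel₀ _ hR.ne']; simp only [α, β]; ring
    have e5 : ∀ t : ℝ, t = R * (2 * (t / (2 * R))) := fun t => by field_simp
    generalize hT : (conj u * d * (conj X * Y)).re = T
    have e6 := e5 T
    linear_combination (-(α + β) / 2 * (‖X‖ ^ 2 + ‖Y‖ ^ 2)) * h1 -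
      ((‖X‖ ^ 2 - ‖Y‖ ^ 2) / 2) * h2' + e6
  have hsum : planeInner u (∑ j, (c j : ℂ) * inner ℂ (e j) (A (e j))) =
      (α + β + R) / 2 * (∑ j, c j * ‖inner ℂ (ξ • x + η • y) (e j)‖ ^ 2) +
      (α + β - R) / 2 * (∑ j, c j * ‖inner ℂ (-conj η • x + conj ξ • y) (e j)‖ ^ 2) := by
    rw [Finset.mul_sum, Finset.mul_sum, ← Finset.sum_add_distrib]
    have : ∀ s : Finset (Fin k), planeInner u (∑ j ∈ s, (c j : ℂ) * inner ℂ (e j) (A (e j))) =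
        ∑ j ∈ s, c j * planeInner u (inner ℂ (e j) (A (e j))) := by
      intro s
      induction s using Finset.cons_induction with
      | empty => simp [planeInner]
      | cons j s hj ih =>
        rw [Finset.sum_cons, Finset.sum_cons, planeInner_add_right, planeInner_ofReal_mul_right, ih]
    rw [this]
    refine Finset.sum_congr rfl fun j _ => ?_
    rw [hform]; ring
  -- Hypothesis `hu` says that the product of the two eigenvalues is at most zero.
  have habs : |α + β| ≤ R := by
    refine abs_le_of_sq_le_sq ?_ hR.le
    rw [hR2]
    simp only [α, β]
    nlinarith
  obtain ⟨hl, hr⟩ := abs_le.1 habs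
  rw [hsum]
  have b1 := mul_le_mul_of_nonneg_left (hle e he _ hnorm.1) (by linarith : 0 ≤ (α + β + R) / 2)
  have b2 := mul_le_mul_of_nonpos_left (hge e he _ hnorm.2.1) (by linarith : (α + β - R) / 2 ≤ 0)
  have e7 : (a + b) * u.re = α + β := by simp only [α, β]; ring
  rw [e7]
  linarith

end Operators

/-! ### Diagonal operators: joining values by rotations between eigenvectors. -/

section Segments

variable {H : Type*} [NormedAddCommGroup H] [InnerProductSpace ℂ H]

/-- Rotating two members of an orthonormal family in the plane they span. -/
theorem Orthonormal.plane_rotation {ι : Type*} [DecidableEq ι] {h : ι → H} (hh : Orthonormal ℂ h)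
    {p q : ι} (hpq : p ≠ q) {C S : ℝ} (hCS : C ^ 2 + S ^ 2 = 1) :
    Orthonormal ℂ (fun m => if m = p then (C : ℂ) • h p + (S : ℂ) • h q
      else if m = q then (-S : ℂ) • h p + (C : ℂ) • h q else h m) := by
  have hCS' : (C : ℂ) ^ 2 + (S : ℂ) ^ 2 = 1 := by exact_mod_cast hCS
  have ho := orthonormal_iff_ite.1 hh
  rw [orthonormal_iff_ite]
  intro m n
  by_cases hmp : m = p
  · subst hmp
    by_cases hnp : n = m
    · subst hnp
      simp only [if_true, inner_add_left, inner_add_right, inner_smul_left, inner_smul_right, ho,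
        hpq, hpq.symm, if_false, Complex.conj_ofReal]
      linear_combination hCS'
    · by_cases hnq : n = q
      · subst hnq
        simp only [if_true, inner_add_left, inner_add_right, inner_smul_left, inner_smul_right, ho,
          hpq, hpq.symm, if_false, Complex.conj_ofReal]
        ring
      · have := Ne.symm hnp
        have := Ne.symm hnq
        simp [inner_add_left, inner_smul_left, -Complex.coe_smul, *]
  · by_cases hmq : m = q
    · subst hmq
      by_cases hnp : n = p
      · subst hnp
        simp only [if_true, inner_add_left, inner_add_right, inner_smul_left, inner_smul_right, ho,
          hpq, hpq.symm, if_false, map_neg, Complex.conj_ofReal]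
        ring
      · by_cases hnq : n = m
        · subst hnq
          simp only [if_true, inner_add_left, inner_add_right, inner_smul_left, inner_smul_right,
            ho, hpq, hpq.symm, if_false, map_neg, Complex.conj_ofReal]
          linear_combination hCS'
        · have := Ne.symm hnp
          have := Ne.symm hnq
          simp [inner_add_left, inner_smul_left, -Complex.coe_smul, *]
    · by_cases hnp : n = p
      · subst hnp
        simp [inner_add_right, inner_smul_right, -Complex.coe_smul, *]
      · by_cases hnq : n = q
        · subst hnq
          simp [inner_add_right, inner_smul_right, -Complex.coe_smul, *]
        · simp [*]

/-- Rotating two eigenvectors by an angle with squared cosine `x` and squared sine `y` turns the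
value into the convex combination of the old value and the swapped one. -/
theorem uIcc_subset_of_diagonal_swap {k r : ℕ} (c : Fin k → ℝ) {A : H →L[ℂ] H}
    {h : Fin k ⊕ Fin r → H} (hh : Orthonormal ℂ h) {α : Fin k ⊕ Fin r → ℝ}
    (hA : ∀ p, A (h p) = (α p : ℂ) • h p) {p q : Fin k ⊕ Fin r} (hpq : p ≠ q) :
    Set.uIcc (∑ m, Sum.elim c 0 m * α m) (∑ m, Sum.elim c 0 m * α (Equiv.swap p q m)) ⊆
      {t : ℝ | (t : ℂ) ∈ cNumericalRange c A} := by
  intro t ht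
  rw [← segment_eq_uIcc] at ht
  obtain ⟨x, y, hx, hy, hxy, rfl⟩ := ht
  have hx2 : √x ^ 2 = x := Real.sq_sqrt hx
  have hy2 : √y ^ 2 = y := Real.sq_sqrt hy
  have hrot := hh.plane_rotation hpq (C := √x) (S := √y) (by rw [hx2, hy2, hxy])
  have hmem := mem_cNumericalRange_of_extended c A hrot
  rw [Set.mem_ofPred_eq]
  convert hmem using 1
  have ho := orthonormal_iff_ite.1 hh
  have hx2' : (√x : ℂ) * (√x : ℂ) = x := by rw [← sq]; exact_mod_cast hx2
  have hy2' : (√y : ℂ) * (√y : ℂ) = y := by rw [← sq]; exact_mod_cast hy2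
  have hxy' : (x : ℂ) + y = 1 := by exact_mod_cast hxy
  simp only [smul_eq_mul, Finset.mul_sum, ← Finset.sum_add_distrib, Complex.ofReal_sum]
  refine Finset.sum_congr rfl fun m _ => ?_
  have key : inner ℂ (if m = p then (√x : ℂ) • h p + (√y : ℂ) • h q
      else if m = q then (-√y : ℂ) • h p + (√x : ℂ) • h q else h m)
      (A (if m = p then (√x : ℂ) • h p + (√y : ℂ) • h q
      else if m = q then (-√y : ℂ) • h p + (√x : ℂ) • h q else h m)) =
      (x : ℂ) * α m + y * α (Equiv.swap p q m) := by
    by_cases hmp : m = p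
    · subst hmp
      simp only [if_true, map_add, map_smul, hA, inner_add_left, inner_add_right, inner_smul_left,
        inner_smul_right, ho, hpq, hpq.symm, if_false, Complex.conj_ofReal, Equiv.swap_apply_left]
      linear_combination (α m : ℂ) * hx2' + (α q : ℂ) * hy2'
    · by_cases hmq : m = q
      · subst hmq
        simp only [if_true, map_add, map_smul, hA, inner_add_left, inner_add_right,
          inner_smul_left, inner_smul_right, ho, hpq, hpq.symm, if_false, Complex.conj_ofReal,
          Equiv.swap_apply_right, map_neg]
        linear_combination (α m : ℂ) * hx2' + (α p : ℂ) * hy2'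
      · simp only [hmp, hmq, if_false, hA, inner_smul_right, ho, if_true,
          Equiv.swap_apply_of_ne_of_ne hmp hmq]
        linear_combination -(α m : ℂ) * hxy'
  rw [key]
  push_cast
  ring

/-- A permutation is a product of transpositions, and the successive intervals share endpoints. -/
theorem uIcc_subset_of_diagonal_perm {k r : ℕ} (c : Fin k → ℝ) {A : H →L[ℂ] H}
    {h : Fin k ⊕ Fin r → H} (hh : Orthonormal ℂ h) {α : Fin k ⊕ Fin r → ℝ}
    (hA : ∀ p, A (h p) = (α p : ℂ) • h p) (σ : Equiv.Perm (Fin k ⊕ Fin r)) :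
    Set.uIcc (∑ m, Sum.elim c 0 m * α m) (∑ m, Sum.elim c 0 m * α (σ m)) ⊆
      {t : ℝ | (t : ℂ) ∈ cNumericalRange c A} := by
  induction σ using Equiv.Perm.swap_induction_on' with
  | one =>
    have hmem := mem_cNumericalRange_of_extended c A hh
    have ho := orthonormal_iff_ite.1 hh
    simp only [hA, inner_smul_right, ho, if_true, mul_one] at hmem
    simpa using hmem
  | mul_swap σ p q hpq ih =>
    refine Set.uIcc_subset_uIcc_union_uIcc.trans (Set.union_subset ih ?_)
    exact uIcc_subset_of_diagonal_swap c (hh.comp _ σ.injective) (α := α ∘ σ)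
      (fun m => hA (σ m)) hpq

theorem exists_perm_pair {ι : Type*} [DecidableEq ι] {i j i' j' : ι} (h : i ≠ j) (h' : i' ≠ j') :
    ∃ σ : Equiv.Perm ι, σ i' = i ∧ σ j' = j := by
  refine ⟨Equiv.swap (Equiv.swap i' i j') j * Equiv.swap i' i, ?_, ?_⟩
  · rw [Equiv.Perm.mul_apply, Equiv.swap_apply_left]
    refine Equiv.swap_apply_of_ne_of_ne (fun hi => h' ?_) h
    rw [eq_comm, Equiv.swap_apply_eq_iff, Equiv.swap_apply_right] at hi
    exact hi.symm
  · rw [Equiv.Perm.mul_apply, Equiv.swap_apply_left]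

theorem uIcc_subset_cNumericalRange {k r : ℕ} (c : Fin k → ℝ) {A : H →L[ℂ] H}
    (hcard : ((k + r : ℕ) : Cardinal) ≤ Module.rank ℂ H) {a b : ℝ}
    (hA : HasTriangularForm A a 0 b) {i j i' j' : Fin k ⊕ Fin r} (h : i ≠ j) (h' : i' ≠ j') :
    Set.uIcc (Sum.elim c 0 i * a + Sum.elim c 0 j * b)
      (Sum.elim c 0 i' * a + Sum.elim c 0 j' * b) ⊆ {t : ℝ | (t : ℂ) ∈ cNumericalRange c A} := by
  obtain ⟨x, y, hxy, hx, hy, h0⟩ := hA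
  obtain ⟨g, hg, rfl, rfl⟩ := exists_orthonormal_pair_extension (by simpa using hcard) hxy h
  obtain ⟨σ, hσi, hσj⟩ := exists_perm_pair h h'
  let α : Fin k ⊕ Fin r → ℝ := fun m => if m = i then a else if m = j then b else 0
  have hα : ∀ p, A (g p) = (α p : ℂ) • g p := by
    intro p
    by_cases hpi : p = i
    · subst hpi; simpa [α] using hx
    · by_cases hpj : p = j
      · subst hpj; simpa [α, hpi] using hy
      · rw [h0 (g p) (hg.2 (Ne.symm hpi)) (hg.2 (Ne.symm hpj))]
        simp [α, hpi, hpj]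
  have := uIcc_subset_of_diagonal_perm c hg hα σ
  rw [Fintype.sum_eq_add i j h (fun m hm => by simp [α, hm.1, hm.2]),
    Fintype.sum_eq_add i' j' h' (fun m hm => by
      have h1 : σ m ≠ i := fun he => hm.1 (σ.injective (he.trans hσi.symm))
      have h2 : σ m ≠ j := fun he => hm.2 (σ.injective (he.trans hσj.symm))
      simp [α, h1, h2]), hσi, hσj] at this
  simpa [α, h.symm] using this

/-- A two-term Ky Fan bound. -/
theorem sum_mul_le_add {ι : Type*} [Fintype ι] {c t : ι → ℝ} {C₁ C₂ : ℝ} (i : ι)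
    (ht0 : ∀ j, 0 ≤ t j) (ht1 : ∀ j, t j ≤ 1) (hC : C₂ ≤ C₁) (hi : c i ≤ C₁)
    (hj : ∀ j, j ≠ i → c j ≤ C₂) (hsum : C₂ * ∑ j, t j ≤ 2 * C₂) :
    ∑ j, c j * t j ≤ C₁ + C₂ := by
  classical
  -- After lowering all weights by `C₂`, only index `i` can contribute positively.
  have h1 : ∑ j, (c j - C₂) * t j ≤ C₁ - C₂ := by
    rw [← Finset.add_sum_erase _ _ (Finset.mem_univ i)]
    have h2 : ∑ j ∈ Finset.univ.erase i, (c j - C₂) * t j ≤ 0 :=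
      Finset.sum_nonpos fun j hj' => mul_nonpos_of_nonpos_of_nonneg
        (sub_nonpos.2 (hj j (Finset.ne_of_mem_erase hj'))) (ht0 j)
    have h3 : (c i - C₂) * t i ≤ C₁ - C₂ := by nlinarith [ht0 i, ht1 i]
    linarith
  simp only [sub_mul, Finset.sum_sub_distrib, ← Finset.mul_sum] at h1
  linarith

theorem diagonal_value {k : ℕ} {c : Fin k → ℝ} {A : H →L[ℂ] H} {a b : ℝ} {x y : H}
    (h : Orthonormal ℂ ![x, y]) (hx : A x = (a : ℂ) • x)
    (hy : A y = (0 : ℂ) • x + (b : ℂ) • y)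
    (h0 : ∀ z : H, inner ℂ x z = 0 → inner ℂ y z = 0 → A z = 0) (e : Fin k → H) :
    ∑ j, (c j : ℂ) * inner ℂ (e j) (A (e j)) =
      ((∑ j, c j * (a * ‖inner ℂ x (e j)‖ ^ 2 + b * ‖inner ℂ y (e j)‖ ^ 2) : ℝ) : ℂ) := by
  rw [Complex.ofReal_sum]
  refine Finset.sum_congr rfl fun j _ => ?_
  rw [inner_apply_of_triangular h hx hy h0]
  push_cast
  ring

theorem segment_ofReal {p q : ℝ} : segment ℝ (p : ℂ) (q : ℂ) = Complex.ofReal '' segment ℝ p q :=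
  (image_segment ℝ Complex.ofRealCLM.toLinearMap.toAffineMap p q).symm

theorem HasTriangularForm.neg_swap {A : H →L[ℂ] H} {a b : ℂ} (h : HasTriangularForm A a 0 b) :
    HasTriangularForm (-A) (-b) 0 (-a) := by
  obtain ⟨x, y, hxy, hx, hy, h0⟩ := h
  refine ⟨y, x, hxy.pair_swap, ?_, ?_, fun z h1 h2 => ?_⟩
  · simpa using hy
  · simpa using hx
  · simp [h0 z h2 h1]

theorem cNumericalRange_neg {k : ℕ} (c : Fin k → ℝ) (A : H →L[ℂ] H) :
    cNumericalRange c A = -cNumericalRange c (-A) := by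
  ext z
  simp [cNumericalRange, neg_eq_iff_eq_neg]

end Segments

/-! ### Extreme weights, sharp bounds, and the individual cases. -/

section Weights

variable {H : Type*} [NormedAddCommGroup H] [InnerProductSpace ℂ H] {k : ℕ}

theorem natCast_add_one_le_rank {n : ℕ} (h : (n : Cardinal) ≤ Module.rank ℂ H)
    (hne : Module.rank ℂ H ≠ n) : ((n + 1 : ℕ) : Cardinal) ≤ Module.rank ℂ H := by
  rw [Nat.cast_succ, ← Cardinal.succ_natCast]
  exact Order.succ_le_of_lt (lt_of_le_of_ne h hne.symm)

theorem cBar_of_rank_eq (h : Module.rank ℂ H = (k : Cardinal)) (c : Fin k → ℝ) (i : Fin k) :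
    cBar H c i = c i := if_pos h

theorem cBar_of_rank_ne (h : Module.rank ℂ H ≠ (k : Cardinal)) (c : Fin k → ℝ) (i : Fin k) :
    cBar H c i = max (c i) 0 := if_neg h

theorem le_cBar (c : Fin k → ℝ) (i : Fin k) : c i ≤ cBar H c i := by
  unfold cBar; split_ifs <;> simp

theorem cBar_mono {c : Fin k → ℝ} {i j : Fin k} (h : c i ≤ c j) : cBar H c i ≤ cBar H c j := by
  unfold cBar; split_ifs
  · exact h
  · exact max_le_max_right 0 h

/-- The duality `c ↦ -c`, by which lower bounds follow from upper ones. -/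
theorem cTilde_eq_neg_cBar_neg (c : Fin k → ℝ) (i : Fin k) :
    cTilde H c i = -cBar H (-c) i := by
  unfold cBar cTilde; split_ifs
  · simp
  · simp [← min_neg_neg]

theorem cTilde_of_rank_eq (h : Module.rank ℂ H = (k : Cardinal)) (c : Fin k → ℝ) (i : Fin k) :
    cTilde H c i = c i := if_pos h

theorem cTilde_of_rank_ne (h : Module.rank ℂ H ≠ (k : Cardinal)) (c : Fin k → ℝ) (i : Fin k) :
    cTilde H c i = min (c i) 0 := if_neg h

theorem cTilde_lt_cBar {c : Fin k → ℝ} {i j : Fin k} (h : c i < c j) :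
    cTilde H c i < cBar H c j := by
  unfold cBar cTilde; split_ifs
  · exact h
  · rcases lt_or_ge (c i) 0 with hi | hi
    · exact lt_of_lt_of_le (min_lt_of_left_lt hi) (le_max_right _ _)
    · exact lt_of_le_of_lt (min_le_left _ _) (lt_of_lt_of_le h (le_max_left _ _))

theorem sum_weight_le_cBar {c : Fin k → ℝ} {i : Fin k} (hi : ∀ j, c j ≤ c i) {e : Fin k → H}
    (he : Orthonormal ℂ e) {U : H} (hU : ‖U‖ = 1) :
    ∑ j, c j * ‖inner ℂ U (e j)‖ ^ 2 ≤ cBar H c i := by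
  have h1 : ∑ j, c j * ‖inner ℂ U (e j)‖ ^ 2 ≤ cBar H c i * ∑ j, ‖inner ℂ U (e j)‖ ^ 2 := by
    rw [Finset.mul_sum]
    gcongr with j
    exact (hi j).trans (le_cBar c i)
  refine h1.trans ?_
  by_cases hr : Module.rank ℂ H = (k : Cardinal)
  · have : Nonempty (Fin k) := ⟨i⟩
    rw [he.sum_sq_norm_inner_eq (by simpa using hr) hU, mul_one]
  · have h0 : 0 ≤ cBar H c i := by rw [cBar_of_rank_ne hr]; exact le_max_right _ _
    exact mul_le_of_le_one_right h0 (he.sum_sq_norm_inner_le hU)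

theorem cTilde_le_sum_weight {c : Fin k → ℝ} {i : Fin k} (hi : ∀ j, c i ≤ c j) {e : Fin k → H}
    (he : Orthonormal ℂ e) {U : H} (hU : ‖U‖ = 1) :
    cTilde H c i ≤ ∑ j, c j * ‖inner ℂ U (e j)‖ ^ 2 := by
  have := sum_weight_le_cBar (c := -c) (i := i) (fun j => neg_le_neg (hi j)) he hU
  rw [cTilde_eq_neg_cBar_neg]
  simp only [Pi.neg_apply, neg_mul, Finset.sum_neg_distrib] at this
  linarith

/-- Abel summation: `a X + b Y = (a - b) X + b (X + Y)` with nonnegative coefficients. The first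
term needs the one-vector bound, the second the Ky Fan bound. -/
theorem sum_diagonal_le {c : Fin k → ℝ} {i j : Fin k} (hi : ∀ m, c m ≤ c i)
    (hj : ∀ m, m ≠ i → c m ≤ c j) {a b : ℝ} (hb : 0 ≤ b) (hab : b ≤ a) {x y : H}
    (hxy : Orthonormal ℂ ![x, y]) {e : Fin k → H} (he : Orthonormal ℂ e) :
    ∑ m, c m * (a * ‖inner ℂ x (e m)‖ ^ 2 + b * ‖inner ℂ y (e m)‖ ^ 2) ≤
      cBar H c i * a + cBar H c j * b := by
  have hn := orthonormal_pair_iff.1 hxy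
  have h1 := sum_weight_le_cBar hi he hn.1
  have h2 : ∑ m, c m * (‖inner ℂ x (e m)‖ ^ 2 + ‖inner ℂ y (e m)‖ ^ 2) ≤
      cBar H c i + cBar H c j := by
    refine sum_mul_le_add i (fun m => by positivity)
      (fun m => hxy.pair_sq_norm_inner_le (he.1 m)) (cBar_mono (hi j)) (le_cBar c i)
      (fun m hm => (hj m hm).trans (le_cBar c j)) ?_
    rw [Finset.sum_add_distrib]
    by_cases hr : Module.rank ℂ H = (k : Cardinal)
    · have : Nonempty (Fin k) := ⟨i⟩
      rw [he.sum_sq_norm_inner_eq (by simpa using hr) hn.1,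
        he.sum_sq_norm_inner_eq (by simpa using hr) hn.2.1]
      linarith
    · have h0 : 0 ≤ cBar H c j := by rw [cBar_of_rank_ne hr]; exact le_max_right _ _
      have := he.sum_sq_norm_inner_le hn.1
      have := he.sum_sq_norm_inner_le hn.2.1
      rw [mul_comm 2]
      gcongr
      linarith
  have e1 : ∑ m, c m * (a * ‖inner ℂ x (e m)‖ ^ 2 + b * ‖inner ℂ y (e m)‖ ^ 2) =
      (a - b) * ∑ m, c m * ‖inner ℂ x (e m)‖ ^ 2 +
      b * ∑ m, c m * (‖inner ℂ x (e m)‖ ^ 2 + ‖inner ℂ y (e m)‖ ^ 2) := by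
    rw [Finset.mul_sum, Finset.mul_sum, ← Finset.sum_add_distrib]
    exact Finset.sum_congr rfl fun m _ => by ring
  rw [e1]
  have h3 := mul_le_mul_of_nonneg_left h1 (sub_nonneg.2 hab)
  have h4 := mul_le_mul_of_nonneg_left h2 hb
  linarith

theorem le_sum_diagonal {c : Fin k → ℝ} {i j : Fin k} (hi : ∀ m, c i ≤ c m)
    (hj : ∀ m, m ≠ i → c j ≤ c m) {a b : ℝ} (hb : 0 ≤ b) (hab : b ≤ a) {x y : H}
    (hxy : Orthonormal ℂ ![x, y]) {e : Fin k → H} (he : Orthonormal ℂ e) :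
    cTilde H c i * a + cTilde H c j * b ≤
      ∑ m, c m * (a * ‖inner ℂ x (e m)‖ ^ 2 + b * ‖inner ℂ y (e m)‖ ^ 2) := by
  have := sum_diagonal_le (c := -c) (i := i) (j := j) (fun m => neg_le_neg (hi m))
    (fun m hm => neg_le_neg (hj m hm)) hb hab hxy he
  rw [cTilde_eq_neg_cBar_neg, cTilde_eq_neg_cBar_neg]
  simp only [Pi.neg_apply, neg_mul, Finset.sum_neg_distrib] at this
  linarith

/-- In codimension one, negative weights cannot avoid the range of a positive operator. -/
theorem sum_diagonal_le_of_neg {c : Fin k → ℝ} {i : Fin k} (hi : ∀ m, c m ≤ c i) (hneg : c i < 0)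
    (hr : Module.rank ℂ H = (k : Cardinal) + 1) {a b : ℝ} (hb : 0 ≤ b) (hab : b ≤ a) {x y : H}
    (hxy : Orthonormal ℂ ![x, y]) {e : Fin k → H} (he : Orthonormal ℂ e) :
    ∑ m, c m * (a * ‖inner ℂ x (e m)‖ ^ 2 + b * ‖inner ℂ y (e m)‖ ^ 2) ≤ c i * b := by
  have h1 := he.one_le_sum_pair (by simpa using hr) hxy
  calc ∑ m, c m * (a * ‖inner ℂ x (e m)‖ ^ 2 + b * ‖inner ℂ y (e m)‖ ^ 2)
      ≤ ∑ m, (c i * b) * (‖inner ℂ x (e m)‖ ^ 2 + ‖inner ℂ y (e m)‖ ^ 2) := by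
        refine Finset.sum_le_sum fun m _ => ?_
        have hp := sq_nonneg ‖inner ℂ x (e m)‖
        have hq := sq_nonneg ‖inner ℂ y (e m)‖
        have ha := hb.trans hab
        -- Here `a X + b Y ≥ b (X + Y)` is multiplied by a negative weight; the last step uses that
        -- the total mass is at least 1.
        rw [mul_assoc]
        refine (mul_le_mul_of_nonneg_right (hi m) (by positivity)).trans
          (mul_le_mul_of_nonpos_left ?_ hneg.le)
        nlinarith
    _ = (c i * b) * ∑ m, (‖inner ℂ x (e m)‖ ^ 2 + ‖inner ℂ y (e m)‖ ^ 2) := by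
        rw [Finset.mul_sum]
    _ ≤ c i * b := by
        have : c i * b ≤ 0 := mul_nonpos_of_nonpos_of_nonneg hneg.le hb
        nlinarith

theorem le_sum_diagonal_of_pos {c : Fin k → ℝ} {i : Fin k} (hi : ∀ m, c i ≤ c m) (hpos : 0 < c i)
    (hr : Module.rank ℂ H = (k : Cardinal) + 1) {a b : ℝ} (hb : 0 ≤ b) (hab : b ≤ a) {x y : H}
    (hxy : Orthonormal ℂ ![x, y]) {e : Fin k → H} (he : Orthonormal ℂ e) :
    c i * b ≤ ∑ m, c m * (a * ‖inner ℂ x (e m)‖ ^ 2 + b * ‖inner ℂ y (e m)‖ ^ 2) := by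
  have := sum_diagonal_le_of_neg (c := -c) (i := i) (fun m => neg_le_neg (hi m))
    (neg_neg_of_pos hpos) hr hb hab hxy he
  simp only [Pi.neg_apply, neg_mul, Finset.sum_neg_distrib] at this
  linarith

/-- A diagonal operator whose extreme values are attained at adapted frames has a segment as its
`c`-numerical range. -/
theorem cNumericalRange_eq_segment {c : Fin k → ℝ} {A : H →L[ℂ] H} {a b : ℝ}
    (hA : HasTriangularForm A a 0 b) {r : ℕ} (hcard : ((k + r : ℕ) : Cardinal) ≤ Module.rank ℂ H)
    {lo hi : ℝ} {i j i' j' : Fin k ⊕ Fin r} (hij : i ≠ j) (hij' : i' ≠ j')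
    (hlo : Sum.elim c 0 i * a + Sum.elim c 0 j * b = lo)
    (hhi : Sum.elim c 0 i' * a + Sum.elim c 0 j' * b = hi)
    (hbd : ∀ x y : H, Orthonormal ℂ ![x, y] → ∀ e : Fin k → H, Orthonormal ℂ e →
      lo ≤ ∑ m, c m * (a * ‖inner ℂ x (e m)‖ ^ 2 + b * ‖inner ℂ y (e m)‖ ^ 2) ∧
      ∑ m, c m * (a * ‖inner ℂ x (e m)‖ ^ 2 + b * ‖inner ℂ y (e m)‖ ^ 2) ≤ hi) :
    cNumericalRange c A = segment ℝ (lo : ℂ) (hi : ℂ) := by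
  have hsub := uIcc_subset_cNumericalRange c hcard hA hij hij'
  rw [hlo, hhi] at hsub
  obtain ⟨x, y, hxy, hx, hy, h0⟩ := hA
  rw [segment_ofReal, segment_eq_uIcc]
  apply Set.Subset.antisymm
  · rintro z ⟨e, he, rfl⟩
    rw [diagonal_value hxy hx hy h0]
    exact ⟨_, Set.Icc_subset_uIcc (hbd x y hxy e he), rfl⟩
  · rintro _ ⟨t, ht, rfl⟩
    exact hsub ht

/-- Each negative weight is replaced by a zero slot; two slots are needed only when both weights are
negative. -/
theorem exists_extended_pair {r : ℕ} (c : Fin k → ℝ) {i j : Fin k} (hij : i ≠ j)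
    (hle : c j ≤ c i) (hr : 2 ≤ r ∨ 1 ≤ r ∧ 0 ≤ c i) :
    ∃ p q : Fin k ⊕ Fin r, p ≠ q ∧ Sum.elim c 0 p = max (c i) 0 ∧
      Sum.elim c 0 q = max (c j) 0 := by
  rcases le_or_gt 0 (c j) with hj | hj
  · exact ⟨Sum.inl i, Sum.inl j, by simpa using hij, by simp [hj.trans hle], by simp [hj]⟩
  rcases le_or_gt 0 (c i) with hi | hi
  · exact ⟨Sum.inl i, Sum.inr ⟨0, by omega⟩, by simp, by simp [hi], by simp [hj.le]⟩
  · have h2 : 2 ≤ r := hr.resolve_right fun h => absurd h.2 (not_le.2 hi)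
    exact ⟨Sum.inr ⟨0, by omega⟩, Sum.inr ⟨1, by omega⟩, by simp, by simp [hi.le], by simp [hj.le]⟩

theorem exists_extended_pair_min {r : ℕ} (c : Fin k → ℝ) {i j : Fin k} (hij : i ≠ j)
    (hle : c i ≤ c j) (hr : 2 ≤ r ∨ 1 ≤ r ∧ c i ≤ 0) :
    ∃ p q : Fin k ⊕ Fin r, p ≠ q ∧ Sum.elim c 0 p = min (c i) 0 ∧
      Sum.elim c 0 q = min (c j) 0 := by
  obtain ⟨p, q, hpq, hp, hq⟩ := exists_extended_pair (r := r) (-c) hij (neg_le_neg hle)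
    (by simpa using hr)
  have hneg : ∀ s : Fin k ⊕ Fin r, Sum.elim (-c) 0 s = -Sum.elim c 0 s := by
    rintro (s | s) <;> simp
  rw [hneg] at hp hq
  refine ⟨p, q, hpq, ?_, ?_⟩
  · rw [← neg_neg (Sum.elim c 0 p), hp, Pi.neg_apply, ← neg_zero, max_neg_neg, neg_neg, neg_zero]
  · rw [← neg_neg (Sum.elim c 0 q), hq, Pi.neg_apply, ← neg_zero, max_neg_neg, neg_neg, neg_zero]

/-- One zero slot suffices: `c i` and `c j` lie on the same side of zero whenever one of them must
be replaced, so the other is kept. -/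
theorem exists_extremal_positions {c : Fin k → ℝ} (hdim : (k : Cardinal) ≤ Module.rank ℂ H)
    {i j : Fin k} (hlt : c j < c i) :
    ∃ (r : ℕ) (p q : Fin k ⊕ Fin r), ((k + r : ℕ) : Cardinal) ≤ Module.rank ℂ H ∧ p ≠ q ∧
      Sum.elim c 0 p = cBar H c i ∧ Sum.elim c 0 q = cTilde H c j := by
  have hne : ∀ {r : ℕ} {p q : Fin k ⊕ Fin r}, Sum.elim c 0 p = cBar H c i →
      Sum.elim c 0 q = cTilde H c j → p ≠ q := by
    rintro r p q hp hq rfl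
    exact absurd (hp.symm.trans hq) (cTilde_lt_cBar hlt).ne'
  by_cases hr : Module.rank ℂ H = (k : Cardinal)
  · have hp : Sum.elim c (0 : Fin 0 → ℝ) (Sum.inl i) = cBar H c i := (cBar_of_rank_eq hr c i).symm
    have hq : Sum.elim c (0 : Fin 0 → ℝ) (Sum.inl j) = cTilde H c j :=
      (cTilde_of_rank_eq hr c j).symm
    exact ⟨0, _, _, hdim, hne hp hq, hp, hq⟩
  · obtain ⟨p, hp⟩ : ∃ p : Fin k ⊕ Fin 1, Sum.elim c 0 p = cBar H c i := by
      rw [cBar_of_rank_ne hr]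
      rcases le_total 0 (c i) with h | h
      · exact ⟨Sum.inl i, by simp [h]⟩
      · exact ⟨Sum.inr 0, by simp [h]⟩
    obtain ⟨q, hq⟩ : ∃ q : Fin k ⊕ Fin 1, Sum.elim c 0 q = cTilde H c j := by
      rw [cTilde_of_rank_ne hr]
      rcases le_total 0 (c j) with h | h
      · exact ⟨Sum.inr 0, by simp [h]⟩
      · exact ⟨Sum.inl j, by simp [h]⟩
    exact ⟨1, p, q, natCast_add_one_le_rank hdim hr, hne hp hq, hp, hq⟩

/-- The `c`-numerical range of a positive semidefinite operator of rank two. -/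
theorem cNumericalRange_of_pos {c : Fin k → ℝ} (hdim : (k : Cardinal) ≤ Module.rank ℂ H)
    {i₁ i₂ iₗ iₖ : Fin k} (h₁₂ : i₁ ≠ i₂) (hₖₗ : iₖ ≠ iₗ) (h₁ : ∀ m, c m ≤ c i₁)
    (h₂ : ∀ m, m ≠ i₁ → c m ≤ c i₂) (hₖ : ∀ m, c iₖ ≤ c m) (hₗ : ∀ m, m ≠ iₖ → c iₗ ≤ c m)
    {A : H →L[ℂ] H} {a b : ℝ} (hA : HasTriangularForm A a 0 b) (hab : a ≥ b) (hb : b > 0) :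
    (¬ (Module.rank ℂ H = (k : Cardinal) + 1 ∧ (c i₁ < 0 ∨ c iₖ > 0)) →
      cNumericalRange c A = segment ℝ
        ((cTilde H c iₖ * a + cTilde H c iₗ * b : ℝ) : ℂ)
        ((cBar H c i₁ * a + cBar H c i₂ * b : ℝ) : ℂ)) ∧
    (Module.rank ℂ H = (k : Cardinal) + 1 → c i₁ < 0 →
      cNumericalRange c A = segment ℝ
        ((c iₖ * a + c iₗ * b : ℝ) : ℂ) ((c i₁ * b : ℝ) : ℂ)) ∧
    (Module.rank ℂ H = (k : Cardinal) + 1 → c iₖ > 0 →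
      cNumericalRange c A = segment ℝ
        ((c iₖ * b : ℝ) : ℂ) ((c i₁ * a + c i₂ * b : ℝ) : ℂ)) := by
  have hupper := fun (x y : H) (hxy : Orthonormal ℂ ![x, y]) (e : Fin k → H)
    (he : Orthonormal ℂ e) => sum_diagonal_le h₁ h₂ hb.le hab hxy he
  have hlower := fun (x y : H) (hxy : Orthonormal ℂ ![x, y]) (e : Fin k → H)
    (he : Orthonormal ℂ e) => le_sum_diagonal hₖ hₗ hb.le hab hxy he
  have hsucc : Module.rank ℂ H = (k : Cardinal) + 1 → Module.rank ℂ H ≠ (k : Cardinal) := by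
    intro h h'
    rw [h'] at h
    exact absurd (by exact_mod_cast h : k = k + 1) (by omega)
  refine ⟨fun hex => ?_, fun hr hneg => ?_, fun hr hpos => ?_⟩
  · by_cases hr : Module.rank ℂ H = (k : Cardinal)
    · refine cNumericalRange_eq_segment (r := 0) (i := Sum.inl iₖ) (j := Sum.inl iₗ)
        (i' := Sum.inl i₁) (j' := Sum.inl i₂) hA hdim (by simpa using hₖₗ) (by simpa using h₁₂) ?_ ?_
        fun x y hxy e he => ⟨hlower x y hxy e he, hupper x y hxy e he⟩
      · simp [cTilde_of_rank_eq hr]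
      · simp [cBar_of_rank_eq hr]
    · obtain ⟨r, hcard, ht, hs⟩ : ∃ r : ℕ, ((k + r : ℕ) : Cardinal) ≤ Module.rank ℂ H ∧
          (2 ≤ r ∨ 1 ≤ r ∧ 0 ≤ c i₁) ∧ (2 ≤ r ∨ 1 ≤ r ∧ c iₖ ≤ 0) := by
        have hk1 := natCast_add_one_le_rank hdim hr
        by_cases hr1 : Module.rank ℂ H = (k : Cardinal) + 1
        · have h3 : ¬ (c i₁ < 0 ∨ c iₖ > 0) := fun h => hex ⟨hr1, h⟩
          rw [not_or, not_lt, not_lt] at h3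
          exact ⟨1, hk1, Or.inr ⟨le_rfl, h3.1⟩, Or.inr ⟨le_rfl, h3.2⟩⟩
        · exact ⟨2, natCast_add_one_le_rank hk1 (by simpa using hr1), Or.inl le_rfl,
            Or.inl le_rfl⟩
      obtain ⟨p, q, hpq, hp, hq⟩ := exists_extended_pair c h₁₂ (h₁ i₂) ht
      obtain ⟨p', q', hpq', hp', hq'⟩ := exists_extended_pair_min c hₖₗ (hₖ iₗ) hs
      refine cNumericalRange_eq_segment hA hcard hpq' hpq ?_ ?_
        fun x y hxy e he => ⟨hlower x y hxy e he, hupper x y hxy e he⟩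
      · rw [hp', hq', cTilde_of_rank_ne hr, cTilde_of_rank_ne hr]
      · rw [hp, hq, cBar_of_rank_ne hr, cBar_of_rank_ne hr]
  · have hne := hsucc hr
    -- With all weights negative, the maximum hides the larger eigenvalue `a` in the only zero slot.
    refine cNumericalRange_eq_segment (r := 1) (i := Sum.inl iₖ) (j := Sum.inl iₗ)
      (i' := Sum.inr 0) (j' := Sum.inl i₁) hA (natCast_add_one_le_rank hdim hne)
      (by simpa using hₖₗ) (by simp) (by simp) (by simp)
      fun x y hxy e he => ⟨?_, sum_diagonal_le_of_neg h₁ hneg hr hb.le hab hxy he⟩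
    have := hlower x y hxy e he
    rwa [cTilde_of_rank_ne hne, cTilde_of_rank_ne hne, min_eq_left ((hₖ i₁).trans hneg.le),
      min_eq_left ((h₁ iₗ).trans hneg.le)] at this
  · have hne := hsucc hr
    refine cNumericalRange_eq_segment (r := 1) (i := Sum.inr 0) (j := Sum.inl iₖ)
      (i' := Sum.inl i₁) (j' := Sum.inl i₂) hA (natCast_add_one_le_rank hdim hne)
      (by simp) (by simpa using h₁₂) (by simp) (by simp)
      fun x y hxy e he => ⟨le_sum_diagonal_of_pos hₖ hpos hr hb.le hab hxy he, ?_⟩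
    have := hupper x y hxy e he
    rwa [cBar_of_rank_ne hne, cBar_of_rank_ne hne, max_eq_left (hpos.le.trans (hₖ i₁)),
      max_eq_left (hpos.le.trans (hₖ i₂))] at this

theorem cNumericalRange_of_indefinite {c : Fin k → ℝ} (hdim : (k : Cardinal) ≤ Module.rank ℂ H)
    {i₁ iₖ : Fin k} (h₁ : ∀ m, c m ≤ c i₁) (hₖ : ∀ m, c iₖ ≤ c m) (hlt : c iₖ < c i₁)
    {A : H →L[ℂ] H} {a b : ℝ} (hA : HasTriangularForm A a 0 b) (ha : a > 0) (hb : 0 > b) :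
    cNumericalRange c A = segment ℝ
      ((cTilde H c iₖ * a + cBar H c i₁ * b : ℝ) : ℂ)
      ((cBar H c i₁ * a + cTilde H c iₖ * b : ℝ) : ℂ) := by
  obtain ⟨r, p, q, hcard, hpq, hp, hq⟩ := exists_extremal_positions hdim hlt
  refine cNumericalRange_eq_segment hA hcard hpq.symm hpq (by rw [hp, hq]) (by rw [hp, hq])
    fun x y hxy e he => ?_
  have hn := orthonormal_pair_iff.1 hxy
  have e1 : ∑ m, c m * (a * ‖inner ℂ x (e m)‖ ^ 2 + b * ‖inner ℂ y (e m)‖ ^ 2) =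
      a * ∑ m, c m * ‖inner ℂ x (e m)‖ ^ 2 + b * ∑ m, c m * ‖inner ℂ y (e m)‖ ^ 2 := by
    rw [Finset.mul_sum, Finset.mul_sum, ← Finset.sum_add_distrib]
    exact Finset.sum_congr rfl fun m _ => by ring
  have u1 := mul_le_mul_of_nonneg_left (sum_weight_le_cBar h₁ he hn.1) ha.le
  have u2 := mul_le_mul_of_nonpos_left (sum_weight_le_cBar h₁ he hn.2.1) hb.le
  have l1 := mul_le_mul_of_nonneg_left (cTilde_le_sum_weight hₖ he hn.1) ha.le
  have l2 := mul_le_mul_of_nonpos_left (cTilde_le_sum_weight hₖ he hn.2.1) hb.le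
  rw [e1]
  constructor <;> linarith

theorem segment_neg_ofReal (p q : ℝ) :
    -segment ℝ (p : ℂ) (q : ℂ) = segment ℝ ((-q : ℝ) : ℂ) ((-p : ℝ) : ℂ) := by
  rw [segment_ofReal, segment_ofReal, segment_eq_uIcc, segment_eq_uIcc, ← Set.image_neg_eq_neg,
    Set.uIcc_comm, ← Set.neg_uIcc, ← Set.image_neg_eq_neg, Set.image_image, Set.image_image]
  simp

/-- The support function of the elliptical disk attached to extreme weights `C₁` and `C₂`. -/
theorem ellipticalDisk_support_eq {C₁ C₂ : ℝ} (hC : C₂ ≤ C₁) (a b δ : ℝ) (u : ℂ) :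
    planeInner u ((((C₁ * a + C₂ * b : ℝ) : ℂ) + ((C₁ * b + C₂ * a : ℝ) : ℂ)) / 2) +
      √(planeInner u ((((C₁ * a + C₂ * b : ℝ) : ℂ) - ((C₁ * b + C₂ * a : ℝ) : ℂ)) / 2) ^ 2 +
        ((C₁ - C₂) * δ / 2) ^ 2 * ‖u‖ ^ 2) =
    (C₁ + C₂) / 2 * ((a + b) * u.re) +
      (C₁ - C₂) / 2 * √((a - b) ^ 2 * u.re ^ 2 + δ ^ 2 * ‖u‖ ^ 2) := by
  have hreal : ∀ t : ℝ, planeInner u (t : ℂ) = u.re * t := fun t => by simp [planeInner]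
  have e1 : (((C₁ * a + C₂ * b : ℝ) : ℂ) + ((C₁ * b + C₂ * a : ℝ) : ℂ)) / 2 =
      (((C₁ + C₂) / 2 * (a + b) : ℝ) : ℂ) := by push_cast; ring
  have e2 : (((C₁ * a + C₂ * b : ℝ) : ℂ) - ((C₁ * b + C₂ * a : ℝ) : ℂ)) / 2 =
      (((C₁ - C₂) / 2 * (a - b) : ℝ) : ℂ) := by push_cast; ring
  have e3 : (u.re * ((C₁ - C₂) / 2 * (a - b))) ^ 2 + ((C₁ - C₂) * δ / 2) ^ 2 * ‖u‖ ^ 2 =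
      ((C₁ - C₂) / 2) ^ 2 * ((a - b) ^ 2 * u.re ^ 2 + δ ^ 2 * ‖u‖ ^ 2) := by ring
  rw [e1, e2, hreal, hreal, e3, Real.sqrt_mul (sq_nonneg _), Real.sqrt_sq (by linarith)]
  ring

theorem cNumericalRange_eq_ellipticalDisk {c : Fin k → ℝ}
    (hdim : (k : Cardinal) ≤ Module.rank ℂ H) {i₁ iₖ : Fin k} (h₁ : ∀ m, c m ≤ c i₁)
    (hₖ : ∀ m, c iₖ ≤ c m) (hlt : c iₖ < c i₁) {A : H →L[ℂ] H} {a b : ℝ} {d : ℂ}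
    (hA : HasTriangularForm A a d b) (hd : ‖d‖ ^ 2 > 4 * |a * b|) :
    0 < (cBar H c i₁ - cTilde H c iₖ) * ‖d‖ ∧
    cNumericalRange c A = ellipticalDisk
      ((cBar H c i₁ * a + cTilde H c iₖ * b : ℝ) : ℂ)
      ((cBar H c i₁ * b + cTilde H c iₖ * a : ℝ) : ℂ)
      ((cBar H c i₁ - cTilde H c iₖ) * ‖d‖) := by
  have hd0 : d ≠ 0 := by
    rintro rfl
    simp only [norm_zero] at hd
    linarith [abs_nonneg (a * b)]
  have hC := cTilde_lt_cBar (H := H) hlt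
  have hpos : 0 < (cBar H c i₁ - cTilde H c iₖ) * ‖d‖ :=
    mul_pos (sub_pos.2 hC) (norm_pos_iff.2 hd0)
  refine ⟨hpos, Set.Subset.antisymm (fun z hz => ?_) ?_⟩
  · refine mem_ellipticalDisk_of_planeInner_le hpos fun u => ?_
    rw [ellipticalDisk_support_eq hC.le]
    refine planeInner_le_of_mem_cNumericalRange hA hd0
      (fun e he U hU => sum_weight_le_cBar h₁ he hU)
      (fun e he U hU => cTilde_le_sum_weight hₖ he hU) ?_ hz
    -- Every direction is indefinite, so the support bound holds for all `u`.
    have h1 : u.re ^ 2 ≤ ‖u‖ ^ 2 := by rw [norm_sq_eq_re_im]; linarith [sq_nonneg u.im]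
    calc 4 * (a * b) * u.re ^ 2 ≤ 4 * |a * b| * u.re ^ 2 := by
          gcongr; exact le_abs_self _
      _ ≤ ‖d‖ ^ 2 * ‖u‖ ^ 2 := by gcongr
  · obtain ⟨r, p, q, hcard, hpq, hp, hq⟩ := exists_extremal_positions hdim hlt
    exact ellipticalDisk_subset_cNumericalRange c hcard hA hpq hp hq hpos

/-- If the two outermost pairs of weights are opposite and the real part of `A` is definite without
`A` being normal, then the support function of the `c`-numerical range is not that of an ellipse. -/
theorem cNumericalRange_ne_ellipticalDisk {c : Fin k → ℝ}
    (hdim : (k : Cardinal) ≤ Module.rank ℂ H) {i₁ iₖ : Fin k} (h₁ : ∀ m, c m ≤ c i₁)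
    (hₖ : ∀ m, c iₖ ≤ c m) (hlt : c iₖ < c i₁) (hsymm : c i₁ + c iₖ = 0)
    (hnonneg : Module.rank ℂ H = (k : Cardinal) → ∃ j, j ≠ i₁ ∧ 0 ≤ c j)
    {A : H →L[ℂ] H} {a b : ℝ} {d : ℂ} (hA : HasTriangularForm A a d b) (ha : 0 < a) (hb : 0 < b)
    (hd : 0 < ‖d‖ ^ 2) (hdab : ‖d‖ ^ 2 < 4 * a * b) (f₁ f₂ : ℂ) (m : ℝ) :
    cNumericalRange c A ≠ ellipticalDisk f₁ f₂ m := by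
  intro hW
  have hd0 : d ≠ 0 := by rintro rfl; simp at hd
  obtain ⟨γ, hγ⟩ : ∃ γ, γ = c i₁ := ⟨_, rfl⟩
  have hcₖ : c iₖ = -γ := by linarith
  have hγ0 : 0 < γ := by linarith
  have hC₁ : cBar H c i₁ = γ := by
    unfold cBar; split_ifs
    · exact hγ.symm
    · rw [← hγ, max_eq_left hγ0.le]
  have hC₂ : cTilde H c iₖ = -γ := by
    unfold cTilde; split_ifs
    · exact hcₖ
    · rw [hcₖ, min_eq_left (by linarith)]
  have hEW : ellipticalDisk ((γ * a + -γ * b : ℝ) : ℂ) ((γ * b + -γ * a : ℝ) : ℂ)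
      ((γ - -γ) * ‖d‖) ⊆ cNumericalRange c A := by
    obtain ⟨r, p, q, hcard, hpq, hp, hq⟩ := exists_extremal_positions hdim hlt
    rw [hC₁] at hp
    rw [hC₂] at hq
    exact ellipticalDisk_subset_cNumericalRange c hcard hA hpq hp hq
      (mul_pos (by linarith) (norm_pos_iff.2 hd0))
  obtain ⟨ctr, hctr⟩ : ∃ ctr, ctr = (f₁ + f₂) / 2 := ⟨_, rfl⟩
  obtain ⟨F, hF⟩ : ∃ F, F = (f₁ - f₂) / 2 := ⟨_, rfl⟩
  have hsupp : ∀ u : ℂ, 4 * (a * b) * u.re ^ 2 ≤ ‖d‖ ^ 2 * ‖u‖ ^ 2 →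
      planeInner u ctr + √(planeInner u F ^ 2 + (m / 2) ^ 2 * ‖u‖ ^ 2) =
        γ * √((a - b) ^ 2 * u.re ^ 2 + ‖d‖ ^ 2 * ‖u‖ ^ 2) := by
    intro u hu
    apply le_antisymm
    · obtain ⟨z, hz, hzu⟩ := exists_mem_ellipticalDisk_planeInner_eq f₁ f₂ m u
      rw [← hW] at hz
      rw [hctr, hF, ← hzu]
      have := planeInner_le_of_mem_cNumericalRange hA hd0 (C₁ := γ) (C₂ := -γ)
        (fun e he U hU => hC₁ ▸ sum_weight_le_cBar h₁ he hU)
        (fun e he U hU => hC₂ ▸ cTilde_le_sum_weight hₖ he hU) hu hz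
      linarith
    · obtain ⟨z, hz, hzu⟩ := exists_mem_ellipticalDisk_planeInner_eq
        ((γ * a + -γ * b : ℝ) : ℂ) ((γ * b + -γ * a : ℝ) : ℂ) ((γ - -γ) * ‖d‖) u
      rw [ellipticalDisk_support_eq (by linarith)] at hzu
      have := hEW hz
      rw [hW] at this
      have := planeInner_le_of_mem_ellipticalDisk u this
      rw [← hctr, ← hF] at this
      linarith
  have hquad : ∀ u : ℂ, 4 * (a * b) * u.re ^ 2 ≤ ‖d‖ ^ 2 * ‖u‖ ^ 2 → planeInner u ctr = 0 ∧
      planeInner u F ^ 2 + (m / 2) ^ 2 * ‖u‖ ^ 2 =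
        γ ^ 2 * ((a - b) ^ 2 * u.re ^ 2 + ‖d‖ ^ 2 * ‖u‖ ^ 2) := by
    intro u hu
    have h1 := hsupp u hu
    -- Only the centre term is odd in `u`, so it vanishes; squaring then leaves an identity of
    -- quadratic forms.
    have h2 := hsupp (-u) (by simpa using hu)
    simp only [planeInner_neg_left, neg_sq, norm_neg, Complex.neg_re] at h2
    have h0 : planeInner u ctr = 0 := by linarith
    refine ⟨h0, ?_⟩
    rw [h0, zero_add] at h1
    have h3 := congrArg (· ^ 2) h1
    simp only [mul_pow] at h3
    rwa [Real.sq_sqrt (by positivity), Real.sq_sqrt (by positivity)] at h3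
  -- Chosen so that the non-vertical directions `(ε, ±1)` lie in the indefinite cone.
  obtain ⟨ε, hε0, hε1, hε⟩ : ∃ ε : ℝ, 0 < ε ∧ ε < 1 ∧ 4 * (a * b) * ε = ‖d‖ ^ 2 := by
    refine ⟨‖d‖ ^ 2 / (4 * (a * b)), by positivity, ?_, by field_simp⟩
    rw [div_lt_one (by positivity)]; linarith
  have hdir : 4 * (a * b) * ε ^ 2 ≤ ‖d‖ ^ 2 * (ε ^ 2 + 1) := by
    have : 4 * (a * b) * ε ^ 2 = ‖d‖ ^ 2 * ε := by rw [← hε]; ring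
    rw [this]
    gcongr
    nlinarith
  obtain ⟨hy0, hv⟩ := hquad ⟨0, 1⟩ (by simp; positivity)
  obtain ⟨hx0, hp⟩ := hquad ⟨ε, 1⟩ (by simpa [norm_sq_eq_re_im] using hdir)
  obtain ⟨-, hq⟩ := hquad ⟨ε, -1⟩ (by simpa [norm_sq_eq_re_im] using hdir)
  simp only [planeInner, norm_sq_eq_re_im ⟨_, _⟩] at hy0 hv hx0 hp hq
  have hctr_re : ctr.re = 0 := by
    have : ε * ctr.re = 0 := by linarith
    exact (mul_eq_zero.1 this).resolve_left hε0.ne'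
  -- Averaging over `(ε, ±1)` kills the mixed term; subtracting the vertical identity isolates the
  -- coefficient of `u.re ^ 2`.
  have hmaj : F.re ^ 2 + (m / 2) ^ 2 = γ ^ 2 * ((a - b) ^ 2 + ‖d‖ ^ 2) := by
    have : ε ^ 2 * (F.re ^ 2 + (m / 2) ^ 2) = ε ^ 2 * (γ ^ 2 * ((a - b) ^ 2 + ‖d‖ ^ 2)) := by
      rw [norm_sq_eq_re_im d]
      linear_combination (hp + hq) / 2 - hv
    exact mul_left_cancel₀ (by positivity) this
  obtain ⟨r, p, q, hcard, hpq, hp', hq'⟩ : ∃ (r : ℕ) (p q : Fin k ⊕ Fin r),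
      ((k + r : ℕ) : Cardinal) ≤ Module.rank ℂ H ∧ p ≠ q ∧ Sum.elim c 0 p = γ ∧
        0 ≤ Sum.elim c 0 q := by
    by_cases hr : Module.rank ℂ H = (k : Cardinal)
    · obtain ⟨j, hj, hj0⟩ := hnonneg hr
      exact ⟨0, Sum.inl i₁, Sum.inl j, hdim, by simpa using hj.symm, by simp [hγ], by simpa using hj0⟩
    · exact ⟨1, Sum.inl i₁, Sum.inr 0, natCast_add_one_le_rank hdim hr, by simp, by simp [hγ],
        by simp⟩
  have hpos : 0 < (a - b) ^ 2 + ‖d‖ ^ 2 := by positivity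
  have hR2 := Real.sq_sqrt hpos.le
  have hR : 0 < √((a - b) ^ 2 + ‖d‖ ^ 2) := Real.sqrt_pos.2 hpos
  obtain ⟨R, hRdef⟩ : ∃ R, R = √((a - b) ^ 2 + ‖d‖ ^ 2) := ⟨_, rfl⟩
  rw [← hRdef] at hR2 hR
  have hRab : R < a + b := by
    refine lt_of_pow_lt_pow_left₀ 2 (by positivity) ?_
    rw [hR2]; linarith
  -- Weight `γ` sits on the top eigenvector of the real part of `A`, and a weight `t ≥ 0` on the
  -- other one.
  have hmem := mem_cNumericalRange_of_sphere c hcard hA hpq (s := (a - b) / R)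
    (w := ((‖d‖ / R : ℝ) : ℂ)) (by
      rw [Complex.norm_real, Real.norm_eq_abs, sq_abs, div_pow, div_pow, ← add_div, hR2,
        div_self hpos.ne'])
  rw [hW] at hmem
  have hle := planeInner_le_of_mem_ellipticalDisk 1 hmem
  rw [← hctr, ← hF, hp'] at hle
  generalize Sum.elim c 0 q = t at hq' hle
  have hval : planeInner 1 ((((γ + t) / 2 * (a + b) : ℝ) : ℂ) + ((γ - t : ℝ) : ℂ) *
      (((a - b) / 2 * ((a - b) / R) : ℝ) + (‖d‖ / 2 : ℝ) * ((‖d‖ / R : ℝ) : ℂ))) =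
      (γ + t) / 2 * (a + b) + (γ - t) * (R / 2) := by
    have : (a - b) / 2 * ((a - b) / R) + ‖d‖ / 2 * (‖d‖ / R) = R / 2 := by
      field_simp; linarith
    rw [← this]
    simp only [← Complex.ofReal_mul, ← Complex.ofReal_add, planeInner, Complex.ofReal_re,
      Complex.ofReal_im, Complex.one_re, Complex.one_im]
    ring
  have hrhs : √(planeInner 1 F ^ 2 + (m / 2) ^ 2 * ‖(1 : ℂ)‖ ^ 2) = γ * R := by
    rw [← Real.sqrt_sq (mul_pos hγ0 hR).le, mul_pow, hR2, ← hmaj]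
    simp [planeInner]
  have hc0 : planeInner 1 ctr = 0 := by simp [planeInner, hctr_re]
  rw [hval, hrhs, hc0] at hle
  -- The inequality reads `γ (a + b + R) / 2 + t (a + b - R) / 2 ≤ γ R`, impossible since `R < a +
  -- b`, `γ > 0` and `t ≥ 0`.
  nlinarith

end Weights

/-! ### The five cases together. -/

theorem proposition2p4 {H : Type*} [NormedAddCommGroup H] [InnerProductSpace ℂ H]
    [CompleteSpace H] (k : ℕ) (hk : 2 ≤ k) (hdim : (k : Cardinal) ≤ Module.rank ℂ H)
    (c : Fin k → ℝ) (hc : Antitone c) (hne : ∃ i j, c i ≠ c j)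
    -- the positions `1`, `2`, `k - 1`, `k` of the sequence `c`, counted from `0`
    (i₁ i₂ iₗ iₖ : Fin k) (hi₁ : (i₁ : ℕ) = 0) (hi₂ : (i₂ : ℕ) = 1)
    (hiₗ : (iₗ : ℕ) = k - 2) (hiₖ : (iₖ : ℕ) = k - 1)
    (A : H →L[ℂ] H) (hrank : Module.rank ℂ (LinearMap.range (A : H →ₗ[ℂ] H)) = 2)
    (a b : ℝ) (d : ℂ) (hA : HasTriangularForm A (a : ℂ) d (b : ℂ)) :
    -- (1)
    (a ≥ b → b > 0 → d = 0 →
      (¬ (Module.rank ℂ H = (k : Cardinal) + 1 ∧ (c i₁ < 0 ∨ c iₖ > 0)) →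
        cNumericalRange c A = segment ℝ
          ((cTilde H c iₖ * a + cTilde H c iₗ * b : ℝ) : ℂ)
          ((cBar H c i₁ * a + cBar H c i₂ * b : ℝ) : ℂ)) ∧
      (Module.rank ℂ H = (k : Cardinal) + 1 → c i₁ < 0 →
        cNumericalRange c A = segment ℝ
          ((c iₖ * a + c iₗ * b : ℝ) : ℂ) ((c i₁ * b : ℝ) : ℂ)) ∧
      (Module.rank ℂ H = (k : Cardinal) + 1 → c iₖ > 0 →
        cNumericalRange c A = segment ℝ
          ((c iₖ * b : ℝ) : ℂ) ((c i₁ * a + c i₂ * b : ℝ) : ℂ))) ∧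
    -- (2)
    (a > 0 → 0 > b → d = 0 →
      cNumericalRange c A = segment ℝ
        ((cTilde H c iₖ * a + cBar H c i₁ * b : ℝ) : ℂ)
        ((cBar H c i₁ * a + cTilde H c iₖ * b : ℝ) : ℂ)) ∧
    -- (3)
    (0 > a → a ≥ b → d = 0 →
      (¬ (Module.rank ℂ H = (k : Cardinal) + 1 ∧ (c i₁ < 0 ∨ c iₖ > 0)) →
        cNumericalRange c A = segment ℝ
          ((cBar H c i₁ * b + cBar H c i₂ * a : ℝ) : ℂ)
          ((cTilde H c iₖ * b + cTilde H c iₗ * a : ℝ) : ℂ)) ∧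
      (Module.rank ℂ H = (k : Cardinal) + 1 → c i₁ < 0 →
        cNumericalRange c A = segment ℝ
          ((c i₁ * a : ℝ) : ℂ) ((c iₖ * b + c iₗ * a : ℝ) : ℂ)) ∧
      (Module.rank ℂ H = (k : Cardinal) + 1 → c iₖ > 0 →
        cNumericalRange c A = segment ℝ
          ((c i₁ * b + c i₂ * a : ℝ) : ℂ) ((c iₖ * a : ℝ) : ℂ))) ∧
    -- (4)
    (‖d‖ ^ 2 > 4 * |a * b| →
      0 < (cBar H c i₁ - cTilde H c iₖ) * ‖d‖ ∧
      cNumericalRange c A = ellipticalDisk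
        ((cBar H c i₁ * a + cTilde H c iₖ * b : ℝ) : ℂ)
        ((cBar H c i₁ * b + cTilde H c iₖ * a : ℝ) : ℂ)
        ((cBar H c i₁ - cTilde H c iₖ) * ‖d‖)) ∧
    -- (5), degenerate elliptical disks (segments and points) included
    (3 ≤ Module.rank ℂ H → c i₁ + c iₖ = 0 → c i₂ + c iₗ = 0 → a > 0 → b > 0 →
      0 < ‖d‖ ^ 2 → ‖d‖ ^ 2 < 4 * a * b →
      ¬ ∃ (f₁ f₂ : ℂ) (m : ℝ), 0 ≤ m ∧ cNumericalRange c A = ellipticalDisk f₁ f₂ m) := by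
  have h₁ : ∀ m, c m ≤ c i₁ := fun m => hc (Fin.le_def.2 (by omega))
  have hₖ : ∀ m, c iₖ ≤ c m := fun m => hc (Fin.le_def.2 (by omega))
  have h₂ : ∀ m, m ≠ i₁ → c m ≤ c i₂ := fun m hm => hc (Fin.le_def.2 (by
    have := fun h => hm (Fin.ext h)
    omega))
  have hₗ : ∀ m, m ≠ iₖ → c iₗ ≤ c m := fun m hm => hc (Fin.le_def.2 (by
    have := fun h => hm (Fin.ext h)
    omega))
  have h₁₂ : i₁ ≠ i₂ := fun h => by rw [h] at hi₁; omega
  have hₖₗ : iₖ ≠ iₗ := fun h => by rw [h] at hiₖ; omega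
  have hlt : c iₖ < c i₁ := by
    obtain ⟨i, j, hij⟩ := hne
    refine lt_of_le_of_ne (h₁ iₖ) fun h => hij ?_
    exact le_antisymm ((h₁ i).trans (h ▸ hₖ j)) ((h₁ j).trans (h ▸ hₖ i))
  refine ⟨?_, ?_, ?_, cNumericalRange_eq_ellipticalDisk hdim h₁ hₖ hlt hA, ?_⟩
  · rintro hab hb rfl
    exact cNumericalRange_of_pos hdim h₁₂ hₖₗ h₁ h₂ hₖ hₗ hA hab hb
  · rintro ha hb rfl
    exact cNumericalRange_of_indefinite hdim h₁ hₖ hlt hA ha hb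
  · rintro ha hab rfl
    -- The negative case is the positive one for `-A`, with eigenvalues `-b ≥ -a > 0`.
    have hA' : HasTriangularForm (-A) ((-b : ℝ) : ℂ) 0 ((-a : ℝ) : ℂ) := by
      simpa using hA.neg_swap
    obtain ⟨g1, g2, g3⟩ := cNumericalRange_of_pos hdim h₁₂ hₖₗ h₁ h₂ hₖ hₗ hA'
      (neg_le_neg hab) (neg_pos.2 ha)
    rw [cNumericalRange_neg c A]
    refine ⟨fun h => ?_, fun hr h => ?_, fun hr h => ?_⟩
    · rw [g1 h, segment_neg_ofReal]
      congr 2 <;> ring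
    · rw [g2 hr h, segment_neg_ofReal]
      congr 2 <;> ring
    · rw [g3 hr h, segment_neg_ofReal]
      congr 2 <;> ring
  · rintro h3 hs₁ hs₂ ha hb hd hdab ⟨f₁, f₂, m, -, hW⟩
    refine cNumericalRange_ne_ellipticalDisk hdim h₁ hₖ hlt hs₁ (fun hr => ?_) hA ha hb hd hdab
      f₁ f₂ m hW
    rw [hr] at h3
    -- If `dim H = k` there is no zero slot, and the second weight must be `c i₂`. From `k ≥ 3` the
    -- index of `i₂` is at most that of `iₗ`, so the vanishing sum `c i₂ + c iₗ` forces `c i₂ ≥ 0`.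
    have h3' : 3 ≤ k := by exact_mod_cast h3
    have : c iₗ ≤ c i₂ := hc (Fin.le_def.2 (by omega))
    exact ⟨i₂, h₁₂.symm, by linarith⟩
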